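/- **Setting.** Let $\mathcal O$ be a Dedekind domain, $\mathfrak p\subset\mathcal O$ a nonzero prime ideal generated by an element $\pi$, with finite residue field $\mathcal O/\mathfrak p$ of cardinality $q$. Put $C_\pi(X,Y)=\pi^{-1}\bigl(X^q+Y^q-(X+Y)^q\bigr)\in\mathcal O[X,Y]$. For a morphism $u\colon A\to B$ of $\mathcal O$-algebras, a $\pi$-derivation relative to $u$ is a map $\delta\colon A\to B$ with $$\delta(x+y)=\delta(x)+\delta(y)+C_\pi(u(x),u(y)),\qquad \delta(xy)=u(x)^q\delta(y)+u(y)^q\delta(x)+\pi\,\delta(x)\delta(y)$$ for all $x,y\in A$. A prolongation sequence $R_*$ over $\mathcal O_*$ consists of $\mathcal O$-algebras $R_n$ ($n\ge 0$), morphisms of $\mathcal O$-algebras $u_n\colon R_n\to R_{n+1}$ and $\pi$-derivations $\delta_n\colon R_n\to R_{n+1}$ relative to $u_n$, such that $u_{n+1}\circ\delta_n=\delta_{n+1}\circ u_n$ and $\delta_n(c\cdot 1)=\frac{c-c^q}{\pi}\cdot 1$ for all $n\geq 0$ and $c\in\mathcal O$. Fix such a sequence $R_*$. **Witt vectors.**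 For an $\mathcal O$-algebra $B$, let $W_n(B)=W_{\pi,q,n}(B)$ be the set $B^{n+1}$ with the unique $\mathcal O$-algebra structure that is functorial in $B$ and makes the ghost map $w\colon W_n(B)\to B^{n+1}$ with components $w_i=\sum_{j=0}^{i}\pi^jx_j^{q^{i-j}}$, $0\le i\le n$, a morphism of $\mathcal O$-algebras to the product algebra. There is a morphism of $\mathcal O$-algebras $\exp_n\colon R_0\to W_n(R_n)$, $c\mapsto(P_0(c),\dots,P_n(c))$, where $P_0(c)=c$ and, for $m\ge1$, $$P_m(c)=\delta (P_{m-1}(c))+\sum_{i=0}^{m-2}\ \sum_{j=1}^{q^{m-1-i}}\pi^{i+j-m}\binom{q^{m-1-i}}{j}P_i(c)^{q(q^{m-1-i}-j)}\bigl(\delta (P_i(c))\bigr)^j\in R_m$$ (the coefficients $\pi^{i+j-m}\binom{q^{m-1-i}}{j}$ lie in $\mathcal O$, and elements of $R_i$ are moved to $R_m$, for $i\le m$, by the maps $u$). For an $R_n$-algebra $B$, the ring $W_n(B)$ is regarded as an $R_0$-algebra through $R_0\xrightarrow{\exp_n}W_n(R_n)\to W_n(B)$. This gives a functor $W_n$ from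 $R_n$-algebras to $R_0$-algebras. **Jet algebras.** For a set $\mathbf x=(x_\gamma)_\gamma$ of indeterminates there is a prolongation sequence $R_0[\mathbf x]\to R_1[\mathbf x,\mathbf x^{(1)}]\to R_2[\mathbf x,\mathbf x^{(1)},\mathbf x^{(2)}]\to\cdots$ whose maps $u_n,\delta_n$ extend those of $R_*$ and satisfy $u_n(x_\gamma^{(r)})=x_\gamma^{(r)}$ and $\delta_n(x_\gamma^{(r)})=x_\gamma^{(r+1)}$ for $0\le r\le n$, where $x_\gamma^{(0)}=x_\gamma$. For an $R_0$-algebra $A$, presented as $A=R_0[\mathbf x]/(\mathbf f)$ in the tautological way (one indeterminate $x_a$ for each $a\in A$, and $\mathbf f$ the family of all polynomials that vanish under $x_a\mapsto a$), put $$J_nA=R_n[\mathbf x,\dots,\mathbf x^{(n)}]/(\mathbf f,\delta\mathbf f,\dots,\delta^n\mathbf f).$$ A morphism $g\colon A\to A'$ of $R_0$-algebras induces $J_nA\to J_nA'$, $x_a^{(r)}\mapsto x_{g(a)}^{(r)}$. This gives Buium's $\pi$-jet algebra functor $J_n$ from $R_0$-algebras to $R_n$-algebras. **Theorem.** For every $n\ge0$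 the functor $J_n$ from the category of $R_0$-algebras to the category of $R_n$-algebras is left adjoint to the functor $W_n=W_{\pi,q,n}$ from $R_n$-algebras to $R_0$-algebras. That is, there are bijections $$\operatorname{Hom}_{R_0}(A,W_n(B))\cong\operatorname{Hom}_{R_n}(J_nA,B)$$ natural in the $R_0$-algebra $A$ and the $R_n$-algebra $B$. (All rings and algebras are commutative with unit.) -/

import Mathlib

open MvPolynomial CategoryTheory

universe u v w

/-- The fixed arithmetic data: a nonzero prime ideal `P` of the Dedekind domain `O`,
generated by `π`, with finite residue field `O ⧸ P`. -/
structure PiDatum (O : Type u) [CommRing O] [IsDedekindDomain O] where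
  P : Ideal O
  isPrime : P.IsPrime
  ne_bot : P ≠ ⊥
  π : O
  span_pi : Ideal.span {π} = P
  finite : Finite (O ⧸ P)

namespace PiDatum

section Basic

variable {O : Type u} [CommRing O] [IsDedekindDomain O] (D : PiDatum O)

/-- The cardinality `q` of the residue field. -/
noncomputable def q : ℕ := Nat.card (O ⧸ D.P)

theorem pi_ne_zero : D.π ≠ 0 := by
  intro h
  apply D.ne_bot
  rw [← D.span_pi, h]
  simp

theorem exists_prime_pow : ∃ p h : ℕ, p.Prime ∧ 0 < h ∧ D.q = p ^ h ∧ D.π ∣ (p : O) := by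
  have := D.isPrime
  have : D.P.IsMaximal := D.isPrime.isMaximal D.ne_bot
  let : Field (O ⧸ D.P) := Ideal.Quotient.field D.P
  have := D.finite
  let := Fintype.ofFinite (O ⧸ D.P)
  obtain ⟨p, hp⟩ := CharP.exists (O ⧸ D.P)
  obtain ⟨n, hprime, hcard⟩ := FiniteField.card (O ⧸ D.P) p
  refine ⟨p, n, hprime, n.pos, ?_, ?_⟩
  · rw [q, Nat.card_eq_fintype_card, hcard]
  · rw [← Ideal.mem_span_singleton, D.span_pi, ← Ideal.Quotient.eq_zero_iff_mem, map_natCast]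
    exact CharP.cast_eq_zero _ p

theorem q_pos : 0 < D.q := by
  obtain ⟨p, h, hp, -, hq, -⟩ := D.exists_prime_pow
  rw [hq]
  exact pow_pos hp.pos h

theorem dvd_pow_q_sub (a : O) : D.π ∣ a - a ^ D.q := by
  have := D.isPrime
  have : D.P.IsMaximal := D.isPrime.isMaximal D.ne_bot
  let : Field (O ⧸ D.P) := Ideal.Quotient.field D.P
  have := D.finite
  let := Fintype.ofFinite (O ⧸ D.P)
  rw [← Ideal.mem_span_singleton, D.span_pi, ← Ideal.Quotient.eq_zero_iff_mem, map_sub, map_pow,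
    q, Nat.card_eq_fintype_card, FiniteField.pow_card, sub_self]

variable {A : Type v} [CommRing A] [Algebra O A]

theorem dvd_q : algebraMap O A D.π ∣ (D.q : A) := by
  obtain ⟨p, h, hp, hh, hq, hd⟩ := D.exists_prime_pow
  have h1 : algebraMap O A D.π ∣ (p : A) := by
    simpa using map_dvd (algebraMap O A) hd
  rw [hq, Nat.cast_pow]
  exact dvd_pow h1 hh.ne'

theorem dvd_add_pow (x y : A) :
    algebraMap O A D.π ∣ x ^ D.q + y ^ D.q - (x + y) ^ D.q := by
  obtain ⟨p, h, hp, hh, hq, hd⟩ := D.exists_prime_pow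
  have h1 : algebraMap O A D.π ∣ (p : A) := by
    simpa using map_dvd (algebraMap O A) hd
  obtain ⟨r, hr⟩ := exists_add_pow_prime_pow_eq hp x y h
  rw [hq, hr]
  refine h1.trans ⟨-(x * y * r), ?_⟩
  ring

/-- Congruences modulo `π ^ k`, `k ≥ 1`, improve by one under `q`-th powers. -/
theorem dvd_pow_sub_pow {x y : A} {k : ℕ} (h : algebraMap O A D.π ^ (k + 1) ∣ x - y) :
    algebraMap O A D.π ^ (k + 2) ∣ x ^ D.q - y ^ D.q := by
  have h1 : algebraMap O A D.π ∣ x - y := (dvd_pow_self _ (Nat.succ_ne_zero k)).trans h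
  rw [← (Commute.all x y).geom_sum₂_mul, pow_succ']
  refine mul_dvd_mul ?_ h
  have h2 : algebraMap O A D.π ∣
      (∑ i ∈ Finset.range D.q, x ^ i * y ^ (D.q - 1 - i)) - D.q * y ^ (D.q - 1) := by
    have : (D.q : A) * y ^ (D.q - 1) = ∑ i ∈ Finset.range D.q, y ^ i * y ^ (D.q - 1 - i) := by
      rw [Finset.sum_congr rfl (g := fun _ => y ^ (D.q - 1))]
      · simp
      · intro i hi
        rw [← pow_add]
        congr 1
        have := Finset.mem_range.1 hi
        omega
    rw [this, ← Finset.sum_sub_distrib]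
    refine Finset.dvd_sum fun i _ => ?_
    rw [← sub_mul]
    exact (h1.trans (sub_dvd_pow_sub_pow x y i)).mul_right _
  simpa using dvd_add h2 ((D.dvd_q (A := A)).mul_right (y ^ (D.q - 1)))

theorem dvd_pow_q_pow_sub {x y : A} (h : algebraMap O A D.π ∣ x - y) (m : ℕ) :
    algebraMap O A D.π ^ (m + 1) ∣ x ^ D.q ^ m - y ^ D.q ^ m := by
  induction m with
  | zero => simpa using h
  | succ m ih =>
    rw [pow_succ D.q, pow_mul, pow_mul]
    exact D.dvd_pow_sub_pow ih

/-- The polynomial `C_π(X, Y) = (X ^ q + Y ^ q - (X + Y) ^ q) / π`. -/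
noncomputable def addPoly : MvPolynomial (Fin 2) O :=
  Classical.choose (D.dvd_add_pow (X 0 : MvPolynomial (Fin 2) O) (X 1))

theorem addPoly_spec :
    (X 0 ^ D.q + X 1 ^ D.q - (X 0 + X 1) ^ D.q : MvPolynomial (Fin 2) O) = C D.π * D.addPoly :=
  Classical.choose_spec (D.dvd_add_pow (X 0 : MvPolynomial (Fin 2) O) (X 1))

/-- The polynomial `((X + π Y) ^ (q ^ m) - X ^ (q ^ m)) / π ^ (m + 1)`, that is,
`∑ j from 1 to q ^ m` of `π ^ (j - m - 1) * binom(q ^ m, j) * X ^ (q ^ m - j) * Y ^ j`. -/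
noncomputable def powPoly (m : ℕ) : MvPolynomial (Fin 2) O :=
  Classical.choose (D.dvd_pow_q_pow_sub
    (x := (X 0 + C D.π * X 1 : MvPolynomial (Fin 2) O)) (y := X 0)
    ⟨X 1, by simp [MvPolynomial.algebraMap_eq]⟩ m)

theorem powPoly_spec (m : ℕ) :
    ((X 0 + C D.π * X 1) ^ D.q ^ m - X 0 ^ D.q ^ m : MvPolynomial (Fin 2) O) =
      C D.π ^ (m + 1) * D.powPoly m :=
  Classical.choose_spec (D.dvd_pow_q_pow_sub
    (x := (X 0 + C D.π * X 1 : MvPolynomial (Fin 2) O)) (y := X 0)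
    ⟨X 1, by simp [MvPolynomial.algebraMap_eq]⟩ m)

theorem addPoly_aeval (x y : A) :
    x ^ D.q + y ^ D.q - (x + y) ^ D.q = algebraMap O A D.π * aeval ![x, y] D.addPoly := by
  have := congrArg (aeval ![x, y]) D.addPoly_spec
  simpa using this

theorem powPoly_aeval (m : ℕ) (x y : A) :
    (x + algebraMap O A D.π * y) ^ D.q ^ m - x ^ D.q ^ m =
      algebraMap O A D.π ^ (m + 1) * aeval ![x, y] (D.powPoly m) := by
  have := congrArg (aeval ![x, y]) (D.powPoly_spec m)
  simpa using this

/-- The unique `π`-derivation `δ a = (a - a ^ q) / π` of `O`. -/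
noncomputable def delta (a : O) : O := Classical.choose (D.dvd_pow_q_sub a)

theorem delta_spec (a : O) : a - a ^ D.q = D.π * D.delta a :=
  Classical.choose_spec (D.dvd_pow_q_sub a)

/-- The `i`-th Witt (ghost) polynomial `x₀ ^ (q ^ i) + π x₁ ^ (q ^ (i - 1)) + ⋯ + π ^ i x_i`. -/
noncomputable def wittGhost (x : ℕ → A) (i : ℕ) : A :=
  ∑ j ∈ Finset.range (i + 1), algebraMap O A D.π ^ j * x j ^ D.q ^ (i - j)

variable (A) in
/-- `A` has no `π`-torsion. -/
def TorsionFree : Prop := ∀ x : A, algebraMap O A D.π * x = 0 → x = 0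

/-- Sequences satisfying the congruences that characterize ghost vectors. -/
def IsGhostSeq (φ : A →ₐ[O] A) (a : ℕ → A) : Prop :=
  ∀ i, algebraMap O A D.π ^ (i + 1) ∣ a (i + 1) - φ (a i)

theorem wittGhost_step (φ : A →ₐ[O] A) (hφ : ∀ a, algebraMap O A D.π ∣ φ a - a ^ D.q)
    (x : ℕ → A) (i : ℕ) :
    algebraMap O A D.π ^ (i + 1) ∣
      ∑ j ∈ Finset.range (i + 1), algebraMap O A D.π ^ j * x j ^ D.q ^ (i + 1 - j) -
        φ (D.wittGhost x i) := by
  rw [wittGhost, map_sum, ← Finset.sum_sub_distrib]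
  refine Finset.dvd_sum fun j hj => ?_
  have hj' : j ≤ i := Nat.lt_succ_iff.1 (Finset.mem_range.1 hj)
  rw [map_mul, map_pow, map_pow, AlgHom.commutes, ← mul_sub, Nat.sub_add_comm hj', pow_succ' D.q,
    pow_mul]
  have h1 : i + 1 = j + (i - j + 1) := by omega
  rw [h1, pow_add]
  refine mul_dvd_mul_left _ ?_
  exact D.dvd_pow_q_pow_sub (by rw [← neg_sub, dvd_neg]; exact hφ _) _

theorem wittGhost_succ (x : ℕ → A) (i : ℕ) :
    D.wittGhost x (i + 1) =
      ∑ j ∈ Finset.range (i + 1), algebraMap O A D.π ^ j * x j ^ D.q ^ (i + 1 - j) +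
        algebraMap O A D.π ^ (i + 1) * x (i + 1) := by
  rw [wittGhost, Finset.sum_range_succ]
  simp

theorem wittGhost_congr {x y : ℕ → A} {i : ℕ} (h : ∀ j ≤ i, x j = y j) :
    D.wittGhost x i = D.wittGhost y i :=
  Finset.sum_congr rfl fun j hj => by rw [h j (Nat.lt_succ_iff.1 (Finset.mem_range.1 hj))]

theorem isGhostSeq_wittGhost (φ : A →ₐ[O] A) (hφ : ∀ a, algebraMap O A D.π ∣ φ a - a ^ D.q)
    (x : ℕ → A) : D.IsGhostSeq φ (D.wittGhost x) := by
  intro i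
  rw [wittGhost_succ, add_sub_right_comm]
  exact dvd_add (D.wittGhost_step φ hφ x i) (dvd_mul_right _ _)

theorem exists_wittGhost_eq (φ : A →ₐ[O] A) (hφ : ∀ a, algebraMap O A D.π ∣ φ a - a ^ D.q)
    (a : ℕ → A) (ha : D.IsGhostSeq φ a) (n : ℕ) :
    ∃ x : ℕ → A, ∀ i ≤ n, D.wittGhost x i = a i := by
  induction n with
  | zero =>
    refine ⟨fun _ => a 0, fun i hi => ?_⟩
    obtain rfl : i = 0 := by omega
    simp [wittGhost]
  | succ n ih =>
    obtain ⟨x, hx⟩ := ih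
    have h1 := D.wittGhost_step φ hφ x n
    rw [hx n le_rfl] at h1
    obtain ⟨c, hc⟩ := dvd_sub (ha n) h1
    refine ⟨fun j => if j = n + 1 then c else x j, fun i hi => ?_⟩
    rcases Nat.lt_or_ge n i with h | h
    · obtain rfl : i = n + 1 := by omega
      rw [wittGhost_succ]
      have : ∀ j ∈ Finset.range (n + 1), algebraMap O A D.π ^ j *
          (if j = n + 1 then c else x j) ^ D.q ^ (n + 1 - j) =
          algebraMap O A D.π ^ j * x j ^ D.q ^ (n + 1 - j) := by
        intro j hj
        rw [if_neg (Finset.mem_range.1 hj).ne]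
      rw [Finset.sum_congr rfl this, if_pos rfl, ← hc]
      ring
    · rw [← hx i h]
      exact D.wittGhost_congr fun j hj => if_neg (by omega)

end Basic
end PiDatum

namespace PiDatum

section

variable {O : Type u} [CommRing O] [IsDedekindDomain O] (D : PiDatum O)

theorem dvd_expand_sub {σ : Type v} (f : MvPolynomial σ O) :
    algebraMap O (MvPolynomial σ O) D.π ∣ expand D.q f - f ^ D.q := by
  induction f using MvPolynomial.induction_on with
  | C a =>
    rw [expand_C, ← map_pow, ← map_sub]
    exact map_dvd (C : O →+* MvPolynomial σ O) (D.dvd_pow_q_sub a)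
  | add f g hf hg =>
    rw [map_add]
    have := dvd_add (dvd_add hf hg) (D.dvd_add_pow f g)
    convert this using 1
    ring
  | mul_X f i hf =>
    rw [map_mul, expand_X, mul_pow, ← sub_mul]
    exact hf.mul_right _

theorem torsionFree_mvPolynomial (σ : Type v) : D.TorsionFree (MvPolynomial σ O) := by
  intro x hx
  rcases mul_eq_zero.1 hx with h | h
  · exact absurd ((C_eq_zero).1 h) D.pi_ne_zero
  · exact h

theorem torsionFree_base : D.TorsionFree O := by
  intro x hx
  rcases mul_eq_zero.1 hx with h | h
  · exact absurd h D.pi_ne_zero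
  · exact h

variable {A : Type v} [CommRing A] [Algebra O A]

theorem TorsionFree.cancel {D : PiDatum O} (h : D.TorsionFree A) {x y : A}
    (e : algebraMap O A D.π * x = algebraMap O A D.π * y) : x = y :=
  sub_eq_zero.1 (h _ (by rw [mul_sub, e, sub_self]))

theorem TorsionFree.cancel_pow {D : PiDatum O} (h : D.TorsionFree A) (k : ℕ) {x y : A}
    (e : algebraMap O A D.π ^ k * x = algebraMap O A D.π ^ k * y) : x = y := by
  induction k with
  | zero => simpa using e
  | succ k ih =>
    refine ih (h.cancel ?_)
    rw [← mul_assoc, ← mul_assoc, ← pow_succ', e]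

theorem wittGhost_map {B : Type w} [CommRing B] [Algebra O B] (f : A →ₐ[O] B) (x : ℕ → A)
    (i : ℕ) : D.wittGhost (fun j => f (x j)) i = f (D.wittGhost x i) := by
  simp [wittGhost]

end

end PiDatum

/-- The set `B ^ (n + 1)` underlying the truncated `π`-typical Witt vectors `W_{π,q,n}(B)`. -/
@[ext]
structure PiWitt {O : Type u} [CommRing O] [IsDedekindDomain O] (D : PiDatum O) (n : ℕ)
    (B : Type v) where
  coeff : Fin (n + 1) → B

namespace PiWitt

section Ring

variable {O : Type u} [CommRing O] [IsDedekindDomain O] {D : PiDatum O} {n : ℕ}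
variable {A : Type v} [CommRing A] [Algebra O A] {B : Type w} [CommRing B] [Algebra O B]

/-- The components of a Witt vector, extended by zero. -/
def ext0 (x : PiWitt D n B) (j : ℕ) : B := if h : j < n + 1 then x.coeff ⟨j, h⟩ else 0

/-- The ghost map `w : W_n(B) → B ^ (n + 1)`. -/
noncomputable def ghost (x : PiWitt D n B) (i : Fin (n + 1)) : B := D.wittGhost x.ext0 i

/-- The map on Witt vectors induced by an `O`-algebra morphism. -/
def mapFun (f : A →ₐ[O] B) (x : PiWitt D n A) : PiWitt D n B := ⟨fun i => f (x.coeff i)⟩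

theorem ext0_mapFun (f : A →ₐ[O] B) (x : PiWitt D n A) (j : ℕ) :
    (mapFun f x).ext0 j = f (x.ext0 j) := by
  unfold ext0 mapFun
  split_ifs <;> simp

theorem ghost_mapFun (f : A →ₐ[O] B) (x : PiWitt D n A) (i : Fin (n + 1)) :
    (mapFun f x).ghost i = f (x.ghost i) := by
  unfold ghost
  rw [← D.wittGhost_map f]
  exact congrArg (fun y => D.wittGhost y i) (funext (ext0_mapFun f x))

theorem ghost_injective (h : D.TorsionFree A) :
    Function.Injective (ghost : PiWitt D n A → Fin (n + 1) → A) := by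
  intro x y e
  have key : ∀ i, i < n + 1 → x.ext0 i = y.ext0 i := by
    intro i
    induction i using Nat.strong_induction_on with
    | _ i ih =>
      intro hi
      have e' : D.wittGhost x.ext0 i = D.wittGhost y.ext0 i := congrFun e ⟨i, hi⟩
      have aux : ∀ z : ℕ → A, D.wittGhost z i =
          (∑ j ∈ Finset.range i, algebraMap O A D.π ^ j * z j ^ D.q ^ (i - j)) +
            algebraMap O A D.π ^ i * z i := fun z => by
        simp [PiDatum.wittGhost, Finset.sum_range_succ]
      rw [aux, aux, Finset.sum_congr rfl (fun j hj => by
        rw [ih j (Finset.mem_range.1 hj) ((Finset.mem_range.1 hj).trans hi)])] at e'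
      exact h.cancel_pow i (add_left_cancel e')
  ext ⟨i, hi⟩
  simpa [ext0, hi] using key i hi

theorem exists_ghost_eq (φ : A →ₐ[O] A) (hφ : ∀ a, algebraMap O A D.π ∣ φ a - a ^ D.q)
    (a : ℕ → A) (ha : D.IsGhostSeq φ a) (n : ℕ) :
    ∃ x : PiWitt D n A, ∀ i : Fin (n + 1), x.ghost i = a i := by
  obtain ⟨x, hx⟩ := D.exists_wittGhost_eq φ hφ a ha n
  refine ⟨⟨fun i => x i⟩, fun i => ?_⟩
  rw [← hx i (by omega)]
  refine D.wittGhost_congr fun j hj => ?_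
  have : j < n + 1 := by omega
  simp [ext0, this]

/-- The two generic Witt vectors, with indeterminate components. -/
noncomputable def gen (D : PiDatum O) (n : ℕ) (k : Fin 2) :
    PiWitt D n (MvPolynomial (Fin 2 × Fin (n + 1)) O) := ⟨fun j => X (k, j)⟩

theorem isGhostSeq_gen (k : Fin 2) :
    D.IsGhostSeq (expand D.q) (D.wittGhost (gen D n k).ext0) :=
  D.isGhostSeq_wittGhost _ D.dvd_expand_sub _

theorem exists_add (D : PiDatum O) (n : ℕ) :
    ∃ s : PiWitt D n (MvPolynomial (Fin 2 × Fin (n + 1)) O),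
      ∀ i, s.ghost i = (gen D n 0).ghost i + (gen D n 1).ghost i :=
  exists_ghost_eq (expand D.q) D.dvd_expand_sub
    (fun i => D.wittGhost (gen D n 0).ext0 i + D.wittGhost (gen D n 1).ext0 i)
    (fun i => by
      have := dvd_add (isGhostSeq_gen (D := D) (n := n) 0 i) (isGhostSeq_gen 1 i)
      simpa only [map_add, add_sub_add_comm] using this) n

theorem exists_mul (D : PiDatum O) (n : ℕ) :
    ∃ s : PiWitt D n (MvPolynomial (Fin 2 × Fin (n + 1)) O),
      ∀ i, s.ghost i = (gen D n 0).ghost i * (gen D n 1).ghost i :=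
  exists_ghost_eq (expand D.q) D.dvd_expand_sub
    (fun i => D.wittGhost (gen D n 0).ext0 i * D.wittGhost (gen D n 1).ext0 i)
    (fun i => by
      have h0 := isGhostSeq_gen (D := D) (n := n) 0 i
      have h1 := isGhostSeq_gen (D := D) (n := n) 1 i
      have := dvd_add (h0.mul_right (D.wittGhost (gen D n 1).ext0 (i + 1)))
        (h1.mul_left (expand D.q (D.wittGhost (gen D n 0).ext0 i)))
      convert this using 1
      rw [map_mul]
      ring) n

theorem exists_neg (D : PiDatum O) (n : ℕ) :
    ∃ s : PiWitt D n (MvPolynomial (Fin 2 × Fin (n + 1)) O),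
      ∀ i, s.ghost i = - (gen D n 0).ghost i :=
  exists_ghost_eq (expand D.q) D.dvd_expand_sub
    (fun i => - D.wittGhost (gen D n 0).ext0 i)
    (fun i => by
      have := (isGhostSeq_gen (D := D) (n := n) 0 i).neg_right
      convert this using 1
      rw [map_neg]
      ring) n

theorem exists_const (D : PiDatum O) (n : ℕ) (c : O) :
    ∃ s : PiWitt D n O, ∀ i, s.ghost i = c :=
  exists_ghost_eq (AlgHom.id O O)
    (fun a => by rw [← dvd_neg, neg_sub]; simpa using (D.dvd_pow_q_sub a).neg_right)
    (fun _ => c) (fun i => by simp) n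

/-- The Witt vector of polynomials giving the sum. -/
noncomputable def sumPoly (D : PiDatum O) (n : ℕ) := Classical.choose (exists_add D n)

/-- The Witt vector of polynomials giving the product. -/
noncomputable def prodPoly (D : PiDatum O) (n : ℕ) := Classical.choose (exists_mul D n)

/-- The Witt vector of polynomials giving the opposite. -/
noncomputable def negPoly (D : PiDatum O) (n : ℕ) := Classical.choose (exists_neg D n)

/-- The Witt vector over `O` with constant ghost vector `(c, …, c)`. -/
noncomputable def const (D : PiDatum O) (n : ℕ) (c : O) : PiWitt D n O :=
  Classical.choose (exists_const D n c)

/-- Evaluation of the generic Witt vectors at `x` and `y`. -/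
noncomputable def evalGen (x y : PiWitt D n B) :
    MvPolynomial (Fin 2 × Fin (n + 1)) O →ₐ[O] B := aeval fun s => (![x, y] s.1).coeff s.2

noncomputable instance : Add (PiWitt D n B) := ⟨fun x y => mapFun (evalGen x y) (sumPoly D n)⟩
noncomputable instance : Mul (PiWitt D n B) := ⟨fun x y => mapFun (evalGen x y) (prodPoly D n)⟩
noncomputable instance : Neg (PiWitt D n B) := ⟨fun x => mapFun (evalGen x x) (negPoly D n)⟩
noncomputable instance : Zero (PiWitt D n B) := ⟨mapFun (Algebra.ofId O B) (const D n 0)⟩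
noncomputable instance : One (PiWitt D n B) := ⟨mapFun (Algebra.ofId O B) (const D n 1)⟩

theorem add_def' (x y : PiWitt D n B) : x + y = mapFun (evalGen x y) (sumPoly D n) := rfl
theorem mul_def' (x y : PiWitt D n B) : x * y = mapFun (evalGen x y) (prodPoly D n) := rfl
theorem neg_def' (x : PiWitt D n B) : -x = mapFun (evalGen x x) (negPoly D n) := rfl
theorem zero_def' : (0 : PiWitt D n B) = mapFun (Algebra.ofId O B) (const D n 0) := rfl
theorem one_def' : (1 : PiWitt D n B) = mapFun (Algebra.ofId O B) (const D n 1) := rfl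

theorem mapFun_evalGen_gen (x y : PiWitt D n B) (k : Fin 2) :
    mapFun (evalGen x y) (gen D n k) = ![x, y] k := by
  ext i
  simp [mapFun, evalGen, gen]

theorem ghost_add (x y : PiWitt D n B) (i : Fin (n + 1)) :
    (x + y).ghost i = x.ghost i + y.ghost i := by
  rw [add_def', ghost_mapFun, sumPoly, Classical.choose_spec (exists_add D n), map_add,
    ← ghost_mapFun, ← ghost_mapFun, mapFun_evalGen_gen, mapFun_evalGen_gen]
  rfl

theorem ghost_mul (x y : PiWitt D n B) (i : Fin (n + 1)) :
    (x * y).ghost i = x.ghost i * y.ghost i := by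
  rw [mul_def', ghost_mapFun, prodPoly, Classical.choose_spec (exists_mul D n), map_mul,
    ← ghost_mapFun, ← ghost_mapFun, mapFun_evalGen_gen, mapFun_evalGen_gen]
  rfl

theorem ghost_neg (x : PiWitt D n B) (i : Fin (n + 1)) : (-x).ghost i = - x.ghost i := by
  rw [neg_def', ghost_mapFun, negPoly, Classical.choose_spec (exists_neg D n), map_neg,
    ← ghost_mapFun, mapFun_evalGen_gen]
  rfl

theorem ghost_const (c : O) (i : Fin (n + 1)) : (const D n c).ghost i = c :=
  Classical.choose_spec (exists_const D n c) i

theorem ghost_zero (i : Fin (n + 1)) : (0 : PiWitt D n B).ghost i = 0 := by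
  rw [zero_def', ghost_mapFun, ghost_const, map_zero]

theorem ghost_one (i : Fin (n + 1)) : (1 : PiWitt D n B).ghost i = 1 := by
  rw [one_def', ghost_mapFun, ghost_const, map_one]

theorem mapFun_mapFun {E : Type*} [CommRing E] [Algebra O E] (g : B →ₐ[O] E) (f : A →ₐ[O] B)
    (x : PiWitt D n A) : mapFun g (mapFun f x) = mapFun (g.comp f) x := rfl

theorem comp_evalGen (f : A →ₐ[O] B) (x y : PiWitt D n A) :
    f.comp (evalGen x y) = evalGen (mapFun f x) (mapFun f y) := by
  ext ⟨k, j⟩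
  fin_cases k <;> simp [evalGen, mapFun]

theorem mapFun_add (f : A →ₐ[O] B) (x y : PiWitt D n A) :
    mapFun f (x + y) = mapFun f x + mapFun f y := by
  rw [add_def', add_def', mapFun_mapFun, comp_evalGen]

theorem mapFun_mul (f : A →ₐ[O] B) (x y : PiWitt D n A) :
    mapFun f (x * y) = mapFun f x * mapFun f y := by
  rw [mul_def', mul_def', mapFun_mapFun, comp_evalGen]

theorem mapFun_neg (f : A →ₐ[O] B) (x : PiWitt D n A) : mapFun f (-x) = -mapFun f x := by
  rw [neg_def', neg_def', mapFun_mapFun, comp_evalGen]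

theorem mapFun_zero (f : A →ₐ[O] B) : mapFun f (0 : PiWitt D n A) = 0 := by
  rw [zero_def', zero_def', mapFun_mapFun]
  congr 1
  exact Subsingleton.elim _ _

theorem mapFun_one (f : A →ₐ[O] B) : mapFun f (1 : PiWitt D n A) = 1 := by
  rw [one_def', one_def', mapFun_mapFun]
  congr 1
  exact Subsingleton.elim _ _

/-- Every Witt vector lifts to a `π`-torsion free algebra. -/
theorem exists_lift (x : PiWitt D n B) :
    ∃ x' : PiWitt D n (MvPolynomial B O), mapFun (aeval id) x' = x :=
  ⟨⟨fun i => X (x.coeff i)⟩, by ext i; simp [mapFun]⟩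

theorem ext_ghost {σ : Type v} {x y : PiWitt D n (MvPolynomial σ O)}
    (h : ∀ i, x.ghost i = y.ghost i) : x = y :=
  ghost_injective (D.torsionFree_mvPolynomial σ) (funext h)

/-- The ring structure on `W_n(B)`: it is functorial in `B` and makes the ghost map a
morphism of rings. -/
noncomputable instance : CommRing (PiWitt D n B) where
  add_assoc x y z := by
    obtain ⟨x, rfl⟩ := exists_lift x
    obtain ⟨y, rfl⟩ := exists_lift y
    obtain ⟨z, rfl⟩ := exists_lift z
    simp only [← mapFun_add]
    exact congrArg _ (ext_ghost fun i => by simp only [ghost_add]; ring)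
  zero_add x := by
    obtain ⟨x, rfl⟩ := exists_lift x
    rw [← mapFun_zero (aeval id : MvPolynomial B O →ₐ[O] B), ← mapFun_add]
    exact congrArg _ (ext_ghost fun i => by simp only [ghost_add, ghost_zero]; ring)
  add_zero x := by
    obtain ⟨x, rfl⟩ := exists_lift x
    rw [← mapFun_zero (aeval id : MvPolynomial B O →ₐ[O] B), ← mapFun_add]
    exact congrArg _ (ext_ghost fun i => by simp only [ghost_add, ghost_zero]; ring)
  add_comm x y := by
    obtain ⟨x, rfl⟩ := exists_lift x
    obtain ⟨y, rfl⟩ := exists_lift y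
    simp only [← mapFun_add]
    exact congrArg _ (ext_ghost fun i => by simp only [ghost_add]; ring)
  mul_assoc x y z := by
    obtain ⟨x, rfl⟩ := exists_lift x
    obtain ⟨y, rfl⟩ := exists_lift y
    obtain ⟨z, rfl⟩ := exists_lift z
    simp only [← mapFun_mul]
    exact congrArg _ (ext_ghost fun i => by simp only [ghost_mul]; ring)
  mul_comm x y := by
    obtain ⟨x, rfl⟩ := exists_lift x
    obtain ⟨y, rfl⟩ := exists_lift y
    simp only [← mapFun_mul]
    exact congrArg _ (ext_ghost fun i => by simp only [ghost_mul]; ring)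
  one_mul x := by
    obtain ⟨x, rfl⟩ := exists_lift x
    rw [← mapFun_one (aeval id : MvPolynomial B O →ₐ[O] B), ← mapFun_mul]
    exact congrArg _ (ext_ghost fun i => by simp only [ghost_mul, ghost_one]; ring)
  mul_one x := by
    obtain ⟨x, rfl⟩ := exists_lift x
    rw [← mapFun_one (aeval id : MvPolynomial B O →ₐ[O] B), ← mapFun_mul]
    exact congrArg _ (ext_ghost fun i => by simp only [ghost_mul, ghost_one]; ring)
  zero_mul x := by
    obtain ⟨x, rfl⟩ := exists_lift x
    rw [← mapFun_zero (aeval id : MvPolynomial B O →ₐ[O] B), ← mapFun_mul]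
    exact congrArg _ (ext_ghost fun i => by simp only [ghost_mul, ghost_zero]; ring)
  mul_zero x := by
    obtain ⟨x, rfl⟩ := exists_lift x
    rw [← mapFun_zero (aeval id : MvPolynomial B O →ₐ[O] B), ← mapFun_mul]
    exact congrArg _ (ext_ghost fun i => by simp only [ghost_mul, ghost_zero]; ring)
  left_distrib x y z := by
    obtain ⟨x, rfl⟩ := exists_lift x
    obtain ⟨y, rfl⟩ := exists_lift y
    obtain ⟨z, rfl⟩ := exists_lift z
    simp only [← mapFun_mul, ← mapFun_add]
    exact congrArg _ (ext_ghost fun i => by simp only [ghost_mul, ghost_add]; ring)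
  right_distrib x y z := by
    obtain ⟨x, rfl⟩ := exists_lift x
    obtain ⟨y, rfl⟩ := exists_lift y
    obtain ⟨z, rfl⟩ := exists_lift z
    simp only [← mapFun_mul, ← mapFun_add]
    exact congrArg _ (ext_ghost fun i => by simp only [ghost_mul, ghost_add]; ring)
  neg_add_cancel x := by
    obtain ⟨x, rfl⟩ := exists_lift x
    rw [← mapFun_zero (aeval id : MvPolynomial B O →ₐ[O] B), ← mapFun_neg, ← mapFun_add]
    exact congrArg _ (ext_ghost fun i => by
      simp only [ghost_add, ghost_neg, ghost_zero]; ring)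
  nsmul := nsmulRec
  zsmul := zsmulRec

/-- The ring morphism `W_n(f)`. -/
noncomputable def mapRing (f : A →ₐ[O] B) : PiWitt D n A →+* PiWitt D n B where
  toFun := mapFun f
  map_one' := mapFun_one f
  map_mul' := mapFun_mul f
  map_zero' := mapFun_zero f
  map_add' := mapFun_add f

theorem mapRing_apply (f : A →ₐ[O] B) (x : PiWitt D n A) : mapRing f x = mapFun f x := rfl

/-- The ring morphism `O → W_n(O)` lifting the diagonal under the ghost map. -/
noncomputable def constHom (D : PiDatum O) (n : ℕ) : O →+* PiWitt D n O where
  toFun := const D n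
  map_one' := ghost_injective D.torsionFree_base (funext fun i => by
    simp only [ghost_const, ghost_one])
  map_mul' a b := ghost_injective D.torsionFree_base (funext fun i => by
    simp only [ghost_mul, ghost_const])
  map_zero' := ghost_injective D.torsionFree_base (funext fun i => by
    simp only [ghost_const, ghost_zero])
  map_add' a b := ghost_injective D.torsionFree_base (funext fun i => by
    simp only [ghost_add, ghost_const])

/-- The `O`-algebra structure on `W_n(B)`. -/
noncomputable instance : Algebra O (PiWitt D n B) :=
  ((mapRing (Algebra.ofId O B)).comp (constHom D n)).toAlgebra

theorem algebraMap_def (c : O) :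
    algebraMap O (PiWitt D n B) c = mapFun (Algebra.ofId O B) (const D n c) := rfl

theorem ghost_algebraMap (c : O) (i : Fin (n + 1)) :
    (algebraMap O (PiWitt D n B) c).ghost i = algebraMap O B c := by
  rw [algebraMap_def, ghost_mapFun, ghost_const]
  rfl

/-- The `O`-algebra morphism `W_n(f)`. -/
noncomputable def map (f : A →ₐ[O] B) : PiWitt D n A →ₐ[O] PiWitt D n B :=
  { mapRing f with
    commutes' := fun c => by
      change mapFun f (mapFun (Algebra.ofId O A) (const D n c)) =
        mapFun (Algebra.ofId O B) (const D n c)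
      rw [mapFun_mapFun]
      congr 1
      exact Subsingleton.elim _ _ }

@[simp] theorem map_coeff (f : A →ₐ[O] B) (x : PiWitt D n A) (i : Fin (n + 1)) :
    (map f x).coeff i = f (x.coeff i) := rfl

theorem map_eq_mapFun (f : A →ₐ[O] B) (x : PiWitt D n A) : map f x = mapFun f x := rfl

theorem ghost_zero_one (x : PiWitt D 1 B) : x.ghost 0 = x.coeff 0 := by
  simp [ghost, PiDatum.wittGhost, ext0]

theorem ghost_one_one (x : PiWitt D 1 B) :
    x.ghost 1 = x.coeff 0 ^ D.q + algebraMap O B D.π * x.coeff 1 := by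
  simp [ghost, PiDatum.wittGhost, ext0, Finset.sum_range_succ]

theorem ext_one {x y : PiWitt D 1 B} (h0 : x.coeff 0 = y.coeff 0) (h1 : x.coeff 1 = y.coeff 1) :
    x = y := by
  ext i
  fin_cases i
  · exact h0
  · exact h1

theorem coeff_add_zero (x y : PiWitt D 1 B) : (x + y).coeff 0 = x.coeff 0 + y.coeff 0 := by
  simp only [← ghost_zero_one, ghost_add]

theorem coeff_mul_zero (x y : PiWitt D 1 B) : (x * y).coeff 0 = x.coeff 0 * y.coeff 0 := by
  simp only [← ghost_zero_one, ghost_mul]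

theorem coeff_algebraMap_zero (c : O) :
    (algebraMap O (PiWitt D 1 B) c).coeff 0 = algebraMap O B c := by
  rw [← ghost_zero_one, ghost_algebraMap]

theorem aeval_pair (f : A →ₐ[O] B) (x y : A) (p : MvPolynomial (Fin 2) O) :
    f (aeval ![x, y] p) = aeval ![f x, f y] p := by
  rw [← AlgHom.comp_apply, comp_aeval]
  congr 2
  ext i
  fin_cases i <;> rfl

theorem coeff_add_one (x y : PiWitt D 1 B) :
    (x + y).coeff 1 = x.coeff 1 + y.coeff 1 + aeval ![x.coeff 0, y.coeff 0] D.addPoly := by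
  obtain ⟨x, rfl⟩ := exists_lift x
  obtain ⟨y, rfl⟩ := exists_lift y
  rw [← mapFun_add]
  simp only [mapFun]
  rw [← aeval_pair, ← map_add, ← map_add]
  congr 1
  refine (D.torsionFree_mvPolynomial B).cancel ?_
  have h := ghost_add x y 1
  simp only [ghost_one_one, coeff_add_zero] at h
  have h2 := D.addPoly_aeval (x.coeff 0) (y.coeff 0)
  linear_combination h + h2

theorem coeff_mul_one (x y : PiWitt D 1 B) :
    (x * y).coeff 1 = x.coeff 0 ^ D.q * y.coeff 1 + y.coeff 0 ^ D.q * x.coeff 1 +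
      algebraMap O B D.π * x.coeff 1 * y.coeff 1 := by
  obtain ⟨x, rfl⟩ := exists_lift x
  obtain ⟨y, rfl⟩ := exists_lift y
  rw [← mapFun_mul]
  simp only [mapFun]
  rw [← AlgHom.commutes (aeval id : MvPolynomial B O →ₐ[O] B)]
  simp only [← map_mul, ← map_add, ← map_pow]
  congr 1
  refine (D.torsionFree_mvPolynomial B).cancel ?_
  have h := ghost_mul x y 1
  simp only [ghost_one_one, coeff_mul_zero] at h
  linear_combination h

theorem coeff_algebraMap_one (c : O) :
    (algebraMap O (PiWitt D 1 B) c).coeff 1 = algebraMap O B (D.delta c) := by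
  rw [algebraMap_def]
  simp only [mapFun, Algebra.ofId_apply]
  congr 1
  refine D.torsionFree_base.cancel ?_
  have h0 := ghost_const (D := D) (n := 1) c 0
  have h := ghost_const (D := D) (n := 1) c 1
  rw [ghost_zero_one] at h0
  rw [ghost_one_one, h0] at h
  have h2 := D.delta_spec c
  simp only [Algebra.algebraMap_self, RingHom.id_apply] at h ⊢
  linear_combination h + h2

end Ring

end PiWitt

/-- `δ` is a `π`-derivation relative to the `O`-algebra morphism `f : A → B`. -/
structure IsPiDerivation {O : Type u} [CommRing O] [IsDedekindDomain O] (D : PiDatum O)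
    {A : Type v} [CommRing A] [Algebra O A] {B : Type w} [CommRing B] [Algebra O B]
    (f : A →ₐ[O] B) (δ : A → B) : Prop where
  map_add : ∀ x y, δ (x + y) = δ x + δ y + aeval ![f x, f y] D.addPoly
  map_mul : ∀ x y, δ (x * y) =
    f x ^ D.q * δ y + f y ^ D.q * δ x + algebraMap O B D.π * δ x * δ y

/-- A prolongation sequence `C₀ → C₁ → C₂ → ⋯` with maps `u n, δ n : C n → C (n + 1)`, lying over
the constant prolongation sequence `O_*` given by `O`, `id` and `D.delta`. -/
structure ProlongationSeq {O : Type u} [CommRing O] [IsDedekindDomain O] (D : PiDatum O)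
    (C : ℕ → Type v) [∀ n, CommRing (C n)] [∀ n, Algebra O (C n)] where
  u : ∀ n, C n →ₐ[O] C (n + 1)
  δ : ∀ n, C n → C (n + 1)
  isPiDerivation : ∀ n, IsPiDerivation D (u n) (δ n)
  u_delta : ∀ n x, u (n + 1) (δ n x) = δ (n + 1) (u n x)
  delta_algebraMap : ∀ n c, δ n (algebraMap O (C n) c) = algebraMap O (C (n + 1)) (D.delta c)

namespace ProlongationSeq

section Basic

variable {O : Type u} [CommRing O] [IsDedekindDomain O] {D : PiDatum O}
variable {C : ℕ → Type v} [∀ n, CommRing (C n)] [∀ n, Algebra O (C n)]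
variable {C' : ℕ → Type w} [∀ n, CommRing (C' n)] [∀ n, Algebra O (C' n)]
variable (S : ProlongationSeq D C) (S' : ProlongationSeq D C')

/-- The composite `C i → C n` of the morphisms `u`. -/
def trans {i n : ℕ} (h : i ≤ n) : C i →ₐ[O] C n :=
  Nat.leRec (motive := fun m _ => C i →ₐ[O] C m) (AlgHom.id O (C i))
    (fun k _ f => (S.u k).comp f) h

@[simp] theorem trans_self (i : ℕ) (x : C i) : S.trans (le_refl i) x = x := by
  simp [trans]

theorem trans_succ {i n : ℕ} (h : i ≤ n) (h' : i ≤ n + 1) (x : C i) :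
    S.trans h' x = S.u n (S.trans h x) := by
  simp [trans, Nat.leRec_succ _ _ h]

theorem trans_trans {i n m : ℕ} (h : i ≤ n) (h' : n ≤ m) (x : C i) :
    S.trans h' (S.trans h x) = S.trans (h.trans h') x := by
  induction m, h' using Nat.le_induction with
  | base => simp
  | succ k hk ih => rw [S.trans_succ hk, ih, S.trans_succ (h.trans hk)]

theorem trans_u {i n : ℕ} (h : i + 1 ≤ n) (x : C i) :
    S.trans h (S.u i x) = S.trans ((Nat.le_succ i).trans h) x := by
  rw [← S.trans_trans (Nat.le_succ i) h, S.trans_succ le_rfl, trans_self]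

theorem delta_trans {i n : ℕ} (h : i ≤ n) (x : C i) :
    S.δ n (S.trans h x) = S.trans (Nat.succ_le_succ h) (S.δ i x) := by
  induction n, h using Nat.le_induction with
  | base => simp
  | succ k hk ih =>
    rw [S.trans_succ hk, ← S.u_delta, ih, ← S.trans_succ]

/-- The ring morphism `C n → W_1(C (n + 1))` with components `u` and `δ`. -/
noncomputable def toWitt (n : ℕ) : C n →+* PiWitt D 1 (C (n + 1)) where
  toFun x := ⟨![S.u n x, S.δ n x]⟩
  map_one' := PiWitt.ext_one
    (by
      have := PiWitt.coeff_algebraMap_zero (D := D) (B := C (n + 1)) 1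
      rw [map_one, map_one] at this
      simp [this])
    (by
      have := PiWitt.coeff_algebraMap_one (D := D) (B := C (n + 1)) 1
      have h := S.delta_algebraMap n 1
      rw [map_one] at this h
      simp [this, h])
  map_mul' x y := PiWitt.ext_one (by simp [PiWitt.coeff_mul_zero])
    (by simp [PiWitt.coeff_mul_one, (S.isPiDerivation n).map_mul])
  map_zero' := PiWitt.ext_one
    (by
      have := PiWitt.coeff_algebraMap_zero (D := D) (B := C (n + 1)) 0
      rw [map_zero, map_zero] at this
      simp [this])
    (by
      have := PiWitt.coeff_algebraMap_one (D := D) (B := C (n + 1)) 0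
      have h := S.delta_algebraMap n 0
      rw [map_zero] at this h
      simp [this, h])
  map_add' x y := PiWitt.ext_one (by simp [PiWitt.coeff_add_zero])
    (by simp [PiWitt.coeff_add_one, (S.isPiDerivation n).map_add])

@[simp] theorem toWitt_coeff_zero (n : ℕ) (x : C n) : (S.toWitt n x).coeff 0 = S.u n x := rfl
@[simp] theorem toWitt_coeff_one (n : ℕ) (x : C n) : (S.toWitt n x).coeff 1 = S.δ n x := rfl

/-- The ring morphism `φ_n : C n → C (n + 1)`, `φ_n x = u_n(x) ^ q + π δ_n(x)`. -/
noncomputable def frob (n : ℕ) : C n →+* C (n + 1) where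
  toFun x := S.u n x ^ D.q + algebraMap O (C (n + 1)) D.π * S.δ n x
  map_one' := by
    have := PiWitt.ghost_one (D := D) (B := C (n + 1)) (n := 1) 1
    rwa [← map_one (S.toWitt n), PiWitt.ghost_one_one] at this
  map_mul' x y := by
    have := PiWitt.ghost_mul (S.toWitt n x) (S.toWitt n y) 1
    rwa [← map_mul (S.toWitt n), PiWitt.ghost_one_one, PiWitt.ghost_one_one,
      PiWitt.ghost_one_one] at this
  map_zero' := by
    have := PiWitt.ghost_zero (D := D) (B := C (n + 1)) (n := 1) 1
    rwa [← map_zero (S.toWitt n), PiWitt.ghost_one_one] at this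
  map_add' x y := by
    have := PiWitt.ghost_add (S.toWitt n x) (S.toWitt n y) 1
    rwa [← map_add (S.toWitt n), PiWitt.ghost_one_one, PiWitt.ghost_one_one,
      PiWitt.ghost_one_one] at this

theorem frob_apply (n : ℕ) (x : C n) :
    S.frob n x = S.u n x ^ D.q + algebraMap O (C (n + 1)) D.π * S.δ n x := rfl

theorem frob_algebraMap (n : ℕ) (c : O) :
    S.frob n (algebraMap O (C n) c) = algebraMap O (C (n + 1)) c := by
  rw [frob_apply, AlgHom.commutes, S.delta_algebraMap, ← map_pow, ← map_mul, ← map_add,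
    ← D.delta_spec]
  simp

/-- The iterate `φ ^ i : C 0 → C i`. -/
noncomputable def frobIter : ∀ i, C 0 →+* C i
  | 0 => RingHom.id _
  | i + 1 => (S.frob i).comp (frobIter i)

/-- The iterate `δ ^ i : C 0 → C i`. -/
def deltaIter : ∀ i, C 0 → C i
  | 0 => id
  | i + 1 => S.δ i ∘ deltaIter i

/-- The components `P_i : C 0 → C i` of the exponential map: `P_0 c = c` and
`P_n = δ P_{n-1} + ∑ i ≤ n - 2, ∑ j from 1 to q ^ (n-1-i),
π ^ (i+j-n) binom(q ^ (n-1-i), j) P_i ^ (q (q ^ (n-1-i) - j)) (δ P_i) ^ j`,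
where the term `δ P_{n-1}` is the summand with index `n - 1`, because `D.powPoly 0` is the
second variable. All terms are moved to `C n` by the transition maps. -/
noncomputable def expCoeff : ∀ i, C 0 → C i
  | 0 => fun c => c
  | n + 1 => fun c => ∑ i : Fin (n + 1),
      aeval ![S.trans (Nat.le_of_lt i.2) (expCoeff i c) ^ D.q, S.trans i.2 (S.δ i (expCoeff i c))]
        (D.powPoly (n - i))

theorem expCoeff_zero (c : C 0) : S.expCoeff 0 c = c := by
  rw [expCoeff]

theorem expCoeff_succ (n : ℕ) (c : C 0) : S.expCoeff (n + 1) c = ∑ i : Fin (n + 1),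
    aeval ![S.trans (Nat.le_of_lt i.2) (S.expCoeff i c) ^ D.q,
      S.trans i.2 (S.δ i (S.expCoeff i c))] (D.powPoly (n - i)) := by
  rw [expCoeff]

/-- The map `exp_n : C 0 → W_n(C n)`, `c ↦ (P_0 c, …, P_n c)`. -/
noncomputable def expFun (n : ℕ) (c : C 0) : PiWitt D n (C n) :=
  ⟨fun i => S.trans (Nat.lt_succ_iff.1 i.2) (S.expCoeff i c)⟩

theorem expCoeff_ghost (i : ℕ) (c : C 0) :
    ∑ j : Fin (i + 1), algebraMap O (C i) D.π ^ (j : ℕ) *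
      S.trans (Nat.lt_succ_iff.1 j.2) (S.expCoeff j c) ^ D.q ^ (i - j) = S.frobIter i c := by
  induction i with
  | zero => simp [expCoeff_zero, frobIter]
  | succ i ih =>
    rw [frobIter, RingHom.comp_apply, ← ih, map_sum, Fin.sum_univ_castSucc]
    simp only [Fin.val_castSucc, Fin.val_last, Nat.sub_self, pow_zero, pow_one, trans_self]
    rw [S.expCoeff_succ, Finset.mul_sum, ← Finset.sum_add_distrib]
    refine Finset.sum_congr rfl fun j _ => ?_
    have hj : (j : ℕ) ≤ i := Nat.lt_succ_iff.1 j.2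
    rw [map_mul, map_pow, map_pow, S.frob_algebraMap, frob_apply, S.delta_trans,
      ← S.trans_succ _ (Nat.le_of_lt j.2)]
    have h := D.powPoly_aeval (i - j)
      (S.trans (Nat.le_of_lt j.2) (S.expCoeff j c) ^ D.q) (S.trans j.2 (S.δ j (S.expCoeff j c)))
    rw [sub_eq_iff_eq_add] at h
    rw [h, mul_add, ← mul_assoc, ← pow_add, ← pow_mul, ← pow_succ',
      show (j : ℕ) + (i - j + 1) = i + 1 by omega, show i + 1 - (j : ℕ) = i - j + 1 by omega]
    exact add_comm _ _

theorem ghost_expFun (n : ℕ) (c : C 0) (i : Fin (n + 1)) :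
    (S.expFun n c).ghost i = S.trans (Nat.lt_succ_iff.1 i.2) (S.frobIter i c) := by
  have hi : (i : ℕ) ≤ n := Nat.lt_succ_iff.1 i.2
  rw [← S.expCoeff_ghost, map_sum, PiWitt.ghost, PiDatum.wittGhost, Finset.sum_range]
  refine Finset.sum_congr rfl fun j _ => ?_
  have hj : (j : ℕ) < n + 1 := by omega
  rw [map_mul, map_pow, map_pow, AlgHom.commutes, S.trans_trans]
  simp [PiWitt.ext0, hj, expFun]

/-- The exponential map as a ring morphism, in the torsion free case. -/
theorem expFun_hom_of_torsionFree (n : ℕ) (h : D.TorsionFree (C n)) :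
    (∀ x y, S.expFun n (x + y) = S.expFun n x + S.expFun n y) ∧
    (∀ x y, S.expFun n (x * y) = S.expFun n x * S.expFun n y) := by
  constructor <;> intro x y <;> refine PiWitt.ghost_injective h (funext fun i => ?_)
  · simp only [PiWitt.ghost_add, ghost_expFun, map_add]
  · simp only [PiWitt.ghost_mul, ghost_expFun, map_mul]

theorem frobIter_algebraMap (i : ℕ) (c : O) :
    S.frobIter i (algebraMap O (C 0) c) = algebraMap O (C i) c := by
  induction i with
  | zero => rfl
  | succ i ih => rw [frobIter, RingHom.comp_apply, ih, frob_algebraMap]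

theorem expFun_algebraMap_of_torsionFree (n : ℕ) (h : D.TorsionFree (C n)) (c : O) :
    S.expFun n (algebraMap O (C 0) c) = algebraMap O (PiWitt D n (C n)) c := by
  refine PiWitt.ghost_injective h (funext fun i => ?_)
  rw [ghost_expFun, frobIter_algebraMap, PiWitt.ghost_algebraMap, AlgHom.commutes]

/-- Morphisms of prolongation sequences. -/
structure Hom where
  f : ∀ n, C n →ₐ[O] C' n
  comm_u : ∀ n x, f (n + 1) (S.u n x) = S'.u n (f n x)
  comm_delta : ∀ n x, f (n + 1) (S.δ n x) = S'.δ n (f n x)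

variable {S S'}

theorem Hom.comm_trans (F : S.Hom S') {i n : ℕ} (h : i ≤ n) (x : C i) :
    F.f n (S.trans h x) = S'.trans h (F.f i x) := by
  induction n, h using Nat.le_induction with
  | base => simp
  | succ k hk ih => rw [S.trans_succ hk, S'.trans_succ hk, F.comm_u, ih]

theorem Hom.comm_deltaIter (F : S.Hom S') (i : ℕ) (x : C 0) :
    F.f i (S.deltaIter i x) = S'.deltaIter i (F.f 0 x) := by
  induction i with
  | zero => rfl
  | succ i ih => simp [deltaIter, F.comm_delta, ih]

theorem Hom.comm_expCoeff (F : S.Hom S') (i : ℕ) (x : C 0) :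
    F.f i (S.expCoeff i x) = S'.expCoeff i (F.f 0 x) := by
  induction i using Nat.strong_induction_on with
  | _ i ih =>
    cases i with
    | zero => rw [expCoeff_zero, expCoeff_zero]
    | succ i =>
      rw [expCoeff_succ, expCoeff_succ, map_sum]
      refine Finset.sum_congr rfl fun j _ => ?_
      rw [PiWitt.aeval_pair, map_pow, F.comm_trans, F.comm_trans, F.comm_delta, ih j j.2]

theorem Hom.comm_expFun (F : S.Hom S') (n : ℕ) (x : C 0) :
    PiWitt.map (F.f n) (S.expFun n x) = S'.expFun n (F.f 0 x) := by
  ext i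
  simp [expFun, F.comm_trans, F.comm_expCoeff]

/-- `Hom` from ring morphisms commuting with the morphisms to `W_1`. -/
def Hom.ofToWitt (f : ∀ n, C n →ₐ[O] C' n)
    (h : ∀ n x, PiWitt.map (f (n + 1)) (S.toWitt n x) = S'.toWitt n (f n x)) : S.Hom S' where
  f := f
  comm_u n x := congrArg (fun z => z.coeff 0) (h n x)
  comm_delta n x := congrArg (fun z => z.coeff 1) (h n x)

end Basic

section Poly

variable {O : Type u} [CommRing O] [IsDedekindDomain O]

/-- The constant prolongation sequence `O_*`. -/
noncomputable def base (D : PiDatum O) : ProlongationSeq D (fun _ => O) where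
  u _ := AlgHom.id O O
  δ _ := D.delta
  isPiDerivation _ := by
    constructor
    · intro x y
      refine D.torsionFree_base.cancel ?_
      have h := D.delta_spec (x + y)
      have hx := D.delta_spec x
      have hy := D.delta_spec y
      have h2 := D.addPoly_aeval x y
      simp only [Algebra.algebraMap_self, RingHom.id_apply, AlgHom.id_apply] at h2 ⊢
      linear_combination hx + hy - h + h2
    · intro x y
      refine D.torsionFree_base.cancel ?_
      have h := D.delta_spec (x * y)
      have hx := D.delta_spec x
      have hy := D.delta_spec y
      have hx' : x = x ^ D.q + D.π * D.delta x := by rw [← hx]; ring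
      have hy' : y = y ^ D.q + D.π * D.delta y := by rw [← hy]; ring
      simp only [Algebra.algebraMap_self, RingHom.id_apply, AlgHom.id_apply]
      rw [← h, mul_pow]
      generalize D.delta x = a at *
      generalize D.delta y = b at *
      linear_combination y * hx' + (x ^ D.q + D.π * a) * hy'
  u_delta _ _ := rfl
  delta_algebraMap _ _ := rfl

variable {D : PiDatum O}
variable {C : ℕ → Type v} [∀ n, CommRing (C n)] [∀ n, Algebra O (C n)]
variable (S : ProlongationSeq D C) (Γ : Type w)

/-- The ring morphism `C_n[x, …, x^(n)] → W_1(C_{n+1}[x, …, x^(n+1)])` which extends the one of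
`C_*` and maps `x^(r)` to `(x^(r), x^(r+1))`. -/
noncomputable def polyHom (n : ℕ) : MvPolynomial (Γ × Fin (n + 1)) (C n) →+*
    PiWitt D 1 (MvPolynomial (Γ × Fin (n + 2)) (C (n + 1))) :=
  eval₂Hom ((PiWitt.map (IsScalarTower.toAlgHom O (C (n + 1))
      (MvPolynomial (Γ × Fin (n + 2)) (C (n + 1))))).toRingHom.comp (S.toWitt n))
    (fun s => ⟨![X (s.1, s.2.castSucc), X (s.1, s.2.succ)]⟩)

theorem polyHom_C (n : ℕ) (a : C n) : S.polyHom Γ n (MvPolynomial.C a) =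
    PiWitt.map (IsScalarTower.toAlgHom O (C (n + 1))
      (MvPolynomial (Γ × Fin (n + 2)) (C (n + 1)))) (S.toWitt n a) := by
  simp [polyHom]

theorem polyHom_X (n : ℕ) (s : Γ × Fin (n + 1)) : S.polyHom Γ n (X s) =
    ⟨![X (s.1, s.2.castSucc), X (s.1, s.2.succ)]⟩ := by
  simp [polyHom]

theorem toWitt_algebraMap (n : ℕ) (c : O) :
    S.toWitt n (algebraMap O (C n) c) = algebraMap O (PiWitt D 1 (C (n + 1))) c :=
  PiWitt.ext_one (by simp [PiWitt.coeff_algebraMap_zero])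
    (by simp [PiWitt.coeff_algebraMap_one, S.delta_algebraMap])

theorem polyHom_algebraMap (n : ℕ) (c : O) : S.polyHom Γ n (algebraMap O _ c) =
    algebraMap O _ c := by
  rw [MvPolynomial.algebraMap_apply, polyHom_C, toWitt_algebraMap, AlgHom.commutes]

/-- The inclusion `C_n[x, …, x^(n)] → C_{n+1}[x, …, x^(n+1)]` extending `u_n`. -/
noncomputable def polyU (n : ℕ) : MvPolynomial (Γ × Fin (n + 1)) (C n) →ₐ[O]
    MvPolynomial (Γ × Fin (n + 2)) (C (n + 1)) :=
  (rename fun s : Γ × Fin (n + 1) => (s.1, s.2.castSucc)).restrictScalars O |>.comp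
    (mapAlgHom (S.u n))

theorem polyHom_coeff_zero (n : ℕ) (x : MvPolynomial (Γ × Fin (n + 1)) (C n)) :
    (S.polyHom Γ n x).coeff 0 = S.polyU Γ n x := by
  induction x using MvPolynomial.induction_on with
  | C a => simp [polyHom_C, polyU, MvPolynomial.algebraMap_eq]
  | add f g hf hg => rw [map_add, map_add, PiWitt.coeff_add_zero, hf, hg]
  | mul_X f s hf =>
    rw [map_mul, map_mul, PiWitt.coeff_mul_zero, hf, polyHom_X]
    simp [polyU]

/-- The prolongation sequence `C_0[x] → C_1[x, x^(1)] → C_2[x, x^(1), x^(2)] → ⋯` in the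
indeterminates `x_γ^(r)`, `γ ∈ Γ`; the `π`-derivation extends the one of `C_*` and maps
`x_γ^(r)` to `x_γ^(r+1)`. -/
noncomputable def poly : ProlongationSeq D (fun n => MvPolynomial (Γ × Fin (n + 1)) (C n)) where
  u n := S.polyU Γ n
  δ n x := (S.polyHom Γ n x).coeff 1
  isPiDerivation n := by
    constructor
    · intro x y
      rw [map_add, PiWitt.coeff_add_one, polyHom_coeff_zero, polyHom_coeff_zero]
    · intro x y
      rw [map_mul, PiWitt.coeff_mul_one, polyHom_coeff_zero, polyHom_coeff_zero]
  u_delta n x := by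
    have h : ((PiWitt.map (S.polyU Γ (n + 1))).toRingHom.comp (S.polyHom Γ n)) =
        (S.polyHom Γ (n + 1)).comp (S.polyU Γ n).toRingHom := by
      refine MvPolynomial.ringHom_ext (fun a => ?_) (fun s => ?_)
      · have h1 : S.polyU Γ n (MvPolynomial.C a) = MvPolynomial.C (S.u n a) := by
          simp [polyU]
        change PiWitt.map (S.polyU Γ (n + 1)) (S.polyHom Γ n (MvPolynomial.C a)) =
          S.polyHom Γ (n + 1) (S.polyU Γ n (MvPolynomial.C a))
        rw [h1, polyHom_C, polyHom_C]
        refine PiWitt.ext_one ?_ ?_ <;>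
          simp [polyU, MvPolynomial.algebraMap_eq, S.u_delta]
      · have h1 : S.polyU Γ n (X s) = X (s.1, s.2.castSucc) := by
          simp [polyU]
        change PiWitt.map (S.polyU Γ (n + 1)) (S.polyHom Γ n (X s)) =
          S.polyHom Γ (n + 1) (S.polyU Γ n (X s))
        rw [h1, polyHom_X, polyHom_X]
        refine PiWitt.ext_one ?_ ?_ <;> simp [polyU]
    exact congrArg (fun z => z.coeff 1) (RingHom.congr_fun h x)
  delta_algebraMap n c := by
    rw [polyHom_algebraMap, PiWitt.coeff_algebraMap_one]

theorem poly_toWitt (n : ℕ) (x : MvPolynomial (Γ × Fin (n + 1)) (C n)) :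
    (S.poly Γ).toWitt n x = S.polyHom Γ n x :=
  PiWitt.ext_one (S.polyHom_coeff_zero Γ n x).symm rfl

theorem poly_u_C (n : ℕ) (a : C n) :
    (S.poly Γ).u n (MvPolynomial.C a) = MvPolynomial.C (S.u n a) := by
  simp [poly, polyU]

theorem poly_u_X (n : ℕ) (s : Γ × Fin (n + 1)) :
    (S.poly Γ).u n (X s) = X (s.1, s.2.castSucc) := by
  simp [poly, polyU]

theorem poly_delta_C (n : ℕ) (a : C n) :
    (S.poly Γ).δ n (MvPolynomial.C a) = MvPolynomial.C (S.δ n a) := by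
  simp [poly, polyHom_C, MvPolynomial.algebraMap_eq]

theorem poly_delta_X (n : ℕ) (s : Γ × Fin (n + 1)) :
    (S.poly Γ).δ n (X s) = X (s.1, s.2.succ) := by
  simp [poly, polyHom_X]

/-- The morphism from the free prolongation sequence over `O_*` determined by elements of
`C 0`. -/
noncomputable def lift (g : Γ → C 0) : ((base D).poly Γ).Hom S :=
  Hom.ofToWitt
    (fun n => aeval fun s : Γ × Fin (n + 1) =>
      S.trans (Nat.lt_succ_iff.1 s.2.2) (S.deltaIter s.2 (g s.1)))
    (fun n x => by
      let F (n : ℕ) : MvPolynomial (Γ × Fin (n + 1)) O →ₐ[O] C n :=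
        aeval fun s : Γ × Fin (n + 1) =>
          S.trans (Nat.lt_succ_iff.1 s.2.2) (S.deltaIter s.2 (g s.1))
      have h : ((PiWitt.map (F (n + 1))).toRingHom.comp ((base D).polyHom Γ n)) =
          (S.toWitt n).comp (F n).toRingHom := by
        refine MvPolynomial.ringHom_ext (fun a => ?_) (fun s => ?_)
        · change PiWitt.map (F (n + 1)) ((base D).polyHom Γ n (algebraMap O _ a)) =
            S.toWitt n (F n (algebraMap O _ a))
          rw [polyHom_algebraMap, AlgHom.commutes, AlgHom.commutes, toWitt_algebraMap]
        · change PiWitt.map (F (n + 1)) ((base D).polyHom Γ n (X s)) = S.toWitt n (F n (X s))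
          rw [polyHom_X]
          refine PiWitt.ext_one ?_ ?_
          · simp [F, S.trans_succ (Nat.lt_succ_iff.1 s.2.2)]
          · simp [F, S.delta_trans, deltaIter]
      rw [poly_toWitt]
      exact RingHom.congr_fun h x)

theorem lift_X (g : Γ → C 0) (γ : Γ) : (S.lift Γ g).f 0 (X (γ, 0)) = g γ := by
  simp [lift, Hom.ofToWitt, deltaIter]

theorem expFun_algebraMap (n : ℕ) (c : O) :
    S.expFun n (algebraMap O (C 0) c) = algebraMap O (PiWitt D n (C n)) c := by
  let F := S.lift (C 0) id
  have h := congrArg (PiWitt.map (F.f n)) (((base D).poly (C 0)).expFun_algebraMap_of_torsionFree n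
    (D.torsionFree_mvPolynomial _) c)
  rwa [F.comm_expFun, AlgHom.commutes, AlgHom.commutes] at h

/-- The morphism of `O`-algebras `exp_n : C 0 → W_n(C n)`, `c ↦ (P_0 c, …, P_n c)`. -/
noncomputable def exp (n : ℕ) : C 0 →ₐ[O] PiWitt D n (C n) where
  toFun := S.expFun n
  map_one' := by simpa using S.expFun_algebraMap n 1
  map_mul' x y := by
    let F := S.lift (C 0) id
    have h := (((base D).poly (C 0)).expFun_hom_of_torsionFree n
      (D.torsionFree_mvPolynomial _)).2 (X (x, 0)) (X (y, 0))
    have h2 := congrArg (PiWitt.map (F.f n)) h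
    rw [map_mul, F.comm_expFun, F.comm_expFun, F.comm_expFun, map_mul, S.lift_X,
      S.lift_X] at h2
    exact h2
  map_zero' := by simpa using S.expFun_algebraMap n 0
  map_add' x y := by
    let F := S.lift (C 0) id
    have h := (((base D).poly (C 0)).expFun_hom_of_torsionFree n
      (D.torsionFree_mvPolynomial _)).1 (X (x, 0)) (X (y, 0))
    have h2 := congrArg (PiWitt.map (F.f n)) h
    rw [map_add, F.comm_expFun, F.comm_expFun, F.comm_expFun, map_add, S.lift_X,
      S.lift_X] at h2
    exact h2
  commutes' := S.expFun_algebraMap n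

variable {Γ} {Γ' : Type w}

/-- Renaming the indeterminates is a morphism of prolongation sequences. -/
noncomputable def polyMap (g : Γ → Γ') : (S.poly Γ).Hom (S.poly Γ') :=
  Hom.ofToWitt
    (fun n => (rename (Prod.map g (id : Fin (n + 1) → Fin (n + 1)))).restrictScalars O)
    (fun n x => by
      let F (n : ℕ) : MvPolynomial (Γ × Fin (n + 1)) (C n) →ₐ[O]
          MvPolynomial (Γ' × Fin (n + 1)) (C n) :=
        (rename (Prod.map g (id : Fin (n + 1) → Fin (n + 1)))).restrictScalars O
      have h : ((PiWitt.map (F (n + 1))).toRingHom.comp (S.polyHom Γ n)) =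
          (S.polyHom Γ' n).comp (F n).toRingHom := by
        refine MvPolynomial.ringHom_ext (fun a => ?_) (fun s => ?_)
        · have h1 : F n (MvPolynomial.C a) = MvPolynomial.C a := by simp [F]
          change PiWitt.map (F (n + 1)) (S.polyHom Γ n (MvPolynomial.C a)) =
            S.polyHom Γ' n (F n (MvPolynomial.C a))
          rw [h1, polyHom_C, polyHom_C]
          refine PiWitt.ext_one ?_ ?_ <;> simp [F, MvPolynomial.algebraMap_eq]
        · have h1 : F n (X s) = X (g s.1, s.2) := by simp [F, Prod.map]
          change PiWitt.map (F (n + 1)) (S.polyHom Γ n (X s)) = S.polyHom Γ' n (F n (X s))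
          rw [h1, polyHom_X, polyHom_X]
          refine PiWitt.ext_one ?_ ?_ <;> simp [F]
      rw [poly_toWitt, poly_toWitt]
      exact RingHom.congr_fun h x)

theorem polyMap_apply (g : Γ → Γ') (n : ℕ) (x : MvPolynomial (Γ × Fin (n + 1)) (C n)) :
    (S.polyMap g).f n x = rename (Prod.map g id) x := rfl

variable (Γ) in
/-- The ideal `(f, δ f, …, δ^n f)`, `f ∈ s`, of `C_n[x, …, x^(n)]`, where `s` is a set of
polynomials in `C_0[x]`. -/
noncomputable def jetIdeal (s : Set (MvPolynomial (Γ × Fin (0 + 1)) (C 0))) (n : ℕ) :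
    Ideal (MvPolynomial (Γ × Fin (n + 1)) (C n)) :=
  Ideal.span {g | ∃ f ∈ s, ∃ (i : ℕ) (h : i ≤ n),
    g = (S.poly Γ).trans h ((S.poly Γ).deltaIter i f)}

end Poly

section Functors

variable {O : Type u} [CommRing O] [IsDedekindDomain O] {D : PiDatum O}
variable {C : ℕ → Type v} [∀ n, CommRing (C n)] [∀ n, Algebra O (C n)]
variable (S : ProlongationSeq D C) (n : ℕ)

/-- The tautological presentation `R_0[x_a : a ∈ A] → A`, `x_a ↦ a`, of an `R_0`-algebra. -/
noncomputable def pres (R : Type v) [CommRing R] (A : Type v) [CommRing A] [Algebra R A] :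
    MvPolynomial (A × Fin (0 + 1)) R →ₐ[R] A := aeval fun s => s.1

/-- The `π`-jet algebra `J_n A = R_n[x, …, x^(n)] / (f, δ f, …, δ^n f)` of an `R_0`-algebra
`A = R_0[x] / (f)`, with respect to the tautological presentation of `A`, in which the family
`f` consists of all relations. -/
abbrev Jet (A : Type v) [CommRing A] [Algebra (C 0) A] : Type v :=
  MvPolynomial (A × Fin (n + 1)) (C n) ⧸ S.jetIdeal A {f | pres (C 0) A f = 0} n

/-- The morphism `J_n A → J_n A'` induced by a morphism of `R_0`-algebras: it maps
`x_a^(r)` to `x_{g a}^(r)`. -/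
noncomputable def jetMap {A A' : Type v} [CommRing A] [Algebra (C 0) A] [CommRing A']
    [Algebra (C 0) A'] (g : A →ₐ[C 0] A') : S.Jet n A →ₐ[C n] S.Jet n A' :=
  Ideal.quotientMapₐ _ (rename (Prod.map g id)) (by
    rw [jetIdeal, Ideal.span_le]
    rintro _ ⟨f, hf, i, h, rfl⟩
    rw [SetLike.mem_coe, Ideal.mem_comap]
    refine Ideal.subset_span ⟨rename (Prod.map g id) f, ?_, i, h, ?_⟩
    · have e : (pres (C 0) A').comp (rename (Prod.map g id)) = g.comp (pres (C 0) A) := by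
        ext s
        simp [pres]
      have := AlgHom.congr_fun e f
      rw [AlgHom.comp_apply, AlgHom.comp_apply, show pres (C 0) A f = 0 from hf, map_zero] at this
      exact this
    · have h1 := (S.polyMap (g : A → A')).comm_trans h ((S.poly A).deltaIter i f)
      rw [Hom.comm_deltaIter] at h1
      exact h1)

theorem jetMap_mk {A A' : Type v} [CommRing A] [Algebra (C 0) A] [CommRing A']
    [Algebra (C 0) A'] (g : A →ₐ[C 0] A') (x : MvPolynomial (A × Fin (n + 1)) (C n)) :
    S.jetMap n g (Ideal.Quotient.mk _ x) = Ideal.Quotient.mk _ (rename (Prod.map g id) x) := rfl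

/-- The functor `J_n` from `R_0`-algebras to `R_n`-algebras. -/
noncomputable def jetFunctor : CommAlgCat.{v} (C 0) ⥤ CommAlgCat.{v} (C n) where
  obj A := CommAlgCat.of (C n) (S.Jet n A)
  map g := CommAlgCat.ofHom (S.jetMap n g.hom)
  map_id A := by
    ext x
    obtain ⟨x, rfl⟩ := Ideal.Quotient.mk_surjective x
    change S.jetMap n (AlgHom.id (C 0) A) (Ideal.Quotient.mk _ x) = Ideal.Quotient.mk _ x
    rw [jetMap_mk]
    exact congrArg _ (rename_id_apply x)
  map_comp f g := by
    ext x
    obtain ⟨x, rfl⟩ := Ideal.Quotient.mk_surjective x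
    change S.jetMap n (g.hom.comp f.hom) (Ideal.Quotient.mk _ x) =
      S.jetMap n g.hom (S.jetMap n f.hom (Ideal.Quotient.mk _ x))
    rw [jetMap_mk, jetMap_mk, jetMap_mk, rename_rename]
    rfl

/-- The `O`-algebra structure underlying an `R`-algebra, where `R` is an `O`-algebra. -/
abbrev restrictAlgebra (O : Type u) [CommRing O] (R : Type v) [CommRing R] [Algebra O R]
    (B : Type v) [CommRing B] [Algebra R B] : Algebra O B :=
  Algebra.compHom B (algebraMap O R)

/-- The structure morphism `R → B` as a morphism of `O`-algebras. -/
def structureHom (O : Type u) [CommRing O] (R : Type v) [CommRing R] [Algebra O R]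
    (B : Type v) [CommRing B] [Algebra R B] :
    letI := restrictAlgebra O R B
    R →ₐ[O] B :=
  letI := restrictAlgebra O R B
  { algebraMap R B with commutes' := fun _ => rfl }

/-- The `R_0`-algebra `W_n(B)` of an `R_n`-algebra `B`, with structure morphism
`R_0 → W_n(R_n) → W_n(B)`. -/
noncomputable def wittObj (B : Type v) [CommRing B] [Algebra (C n) B] : CommAlgCat.{v} (C 0) :=
  letI := restrictAlgebra O (C n) B
  letI : Algebra (C 0) (PiWitt D n B) :=
    ((PiWitt.map (structureHom O (C n) B)).comp (S.exp n)).toRingHom.toAlgebra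
  CommAlgCat.of (C 0) (PiWitt D n B)

/-- The morphism of `R_0`-algebras `W_n(g)`, `(b_0, …, b_n) ↦ (g b_0, …, g b_n)`. -/
noncomputable def wittMap {B B' : Type v} [CommRing B] [Algebra (C n) B] [CommRing B']
    [Algebra (C n) B'] (g : B →ₐ[C n] B') : S.wittObj n B ⟶ S.wittObj n B' :=
  letI := restrictAlgebra O (C n) B
  letI := restrictAlgebra O (C n) B'
  letI : Algebra (C 0) (PiWitt D n B) :=
    ((PiWitt.map (structureHom O (C n) B)).comp (S.exp n)).toRingHom.toAlgebra
  letI : Algebra (C 0) (PiWitt D n B') :=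
    ((PiWitt.map (structureHom O (C n) B')).comp (S.exp n)).toRingHom.toAlgebra
  let gO : B →ₐ[O] B' := { g with commutes' := fun c => g.commutes (algebraMap O (C n) c) }
  CommAlgCat.ofHom (X := PiWitt D n B) (Y := PiWitt D n B')
    { (PiWitt.map gO : PiWitt D n B →ₐ[O] PiWitt D n B') with
      commutes' := fun c => PiWitt.ext (_root_.funext fun i => g.commutes ((S.exp n c).coeff i)) }

/-- The functor `W_n = W_{π,q,n}` from `R_n`-algebras to `R_0`-algebras. -/
noncomputable def wittFunctor : CommAlgCat.{v} (C n) ⥤ CommAlgCat.{v} (C 0) where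
  obj B := S.wittObj n B
  map g := S.wittMap n g.hom
  map_id _ := rfl
  map_comp _ _ := rfl

end Functors

end ProlongationSeq

/-!
A morphism of `C n`-algebras `θ : C_n[x, …, x^(n)] → B` produces the morphism of `C 0`-algebras
`C_0[x] → W_n(C_n[x, …, x^(n)]) → W_n(B)`, the composite of the exponential map of the jet
polynomial sequence with `W_n(θ)`; in components, `f ↦ (θ (P_0 f), …, θ (P_n f))`. The adjunction
bijection is this construction passed to quotients, and both of its halves rest on one fact, the
triangularity of the exponential map (`ProlongationSeq.exists_expCoeff_succ_eq`): for `i ≥ 1`, `P_i c` equals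
`δ^i c` plus an element that comes from level `i - 1` and lies in the ideal
`(c, δ c, …, δ^(i-1) c)` there.

* For `c = x_γ` this says that `P_i (x_γ)` is `x_γ^(i)` plus a polynomial in the indeterminates of
  lower order. Hence `θ` is determined by the values `θ (P_i (x_γ))`
  (`ProlongationSeq.poly_algHom_ext`), which can be prescribed freely
  (`ProlongationSeq.exists_poly_algHom`); so `θ` amounts to a morphism `C_0[x] → W_n(B)`.
* For `c = f` a relation of `A`, it says that `θ` kills `f, δ f, …, δ^n f` if and only if it kills
  `P_0 f, …, P_n f`, that is, if and only if `C_0[x] → W_n(B)` kills `f`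
  (`ProlongationSeq.jetIdeal_le_ker_iff`); so `θ` factors through `J_n A` exactly when the
  corresponding morphism factors through `A`.

The resulting map sends `φ : J_n A → B` to `a ↦ W_n(φ)(exp_n(x_a))`, a formula from which
naturality in `A` and in `B` is read off.
-/

/-! ### Polynomials without constant term -/

namespace PiDatum

variable {O : Type u} [CommRing O] [IsDedekindDomain O] (D : PiDatum O)

theorem constantCoeff_addPoly : constantCoeff D.addPoly = 0 := by
  refine (mul_eq_zero.1 ?_).resolve_left D.pi_ne_zero
  have h := congrArg constantCoeff D.addPoly_spec
  simpa [D.q_pos.ne'] using h.symm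

theorem constantCoeff_powPoly (m : ℕ) : constantCoeff (D.powPoly m) = 0 := by
  refine (mul_eq_zero.1 ?_).resolve_left (pow_ne_zero (m + 1) D.pi_ne_zero)
  have h := congrArg constantCoeff (D.powPoly_spec m)
  simpa [D.q_pos.ne'] using h.symm

theorem powPoly_zero : D.powPoly 0 = X 1 := by
  refine (D.torsionFree_mvPolynomial (Fin 2)).cancel ?_
  have h := D.powPoly_spec 0
  simpa [MvPolynomial.algebraMap_eq] using h.symm

end PiDatum

/-- A polynomial without constant term maps elements of an ideal into that ideal. -/
theorem MvPolynomial.aeval_mem_of_constantCoeff_eq_zero {k : Type u} [CommRing k] {A : Type v}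
    [CommRing A] [Algebra k A] {σ : Type w} {I : Ideal A} {x : σ → A} (hx : ∀ s, x s ∈ I)
    {p : MvPolynomial σ k} (hp : constantCoeff p = 0) : aeval x p ∈ I := by
  rw [← Ideal.Quotient.eq_zero_iff_mem]
  change Ideal.Quotient.mkₐ k I (aeval x p) = 0
  rw [← AlgHom.comp_apply, comp_aeval]
  have h : (fun s => Ideal.Quotient.mkₐ k I (x s)) = fun _ => 0 := by
    funext s
    exact Ideal.Quotient.eq_zero_iff_mem.2 (hx s)
  rw [h, aeval_zero', hp, map_zero]

/-! ### Triangularity of the exponential map -/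

namespace PiWitt

variable {O : Type u} [CommRing O] [IsDedekindDomain O] {D : PiDatum O} {n : ℕ}
variable {B : Type w} [CommRing B] [Algebra O B]

theorem coeff_zero (i : Fin (n + 1)) : (0 : PiWitt D n B).coeff i = 0 := by
  have h : const D n 0 = ⟨fun _ => 0⟩ := by
    refine ghost_injective D.torsionFree_base (funext fun j => ?_)
    rw [ghost_const]
    symm
    rw [ghost, PiDatum.wittGhost]
    refine Finset.sum_eq_zero fun k _ => ?_
    simp [ext0, D.q_pos.ne']
  rw [zero_def', h]
  exact map_zero _

end PiWitt

namespace ProlongationSeq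

section

variable {O : Type u} [CommRing O] [IsDedekindDomain O] {D : PiDatum O}
variable {C : ℕ → Type v} [∀ n, CommRing (C n)] [∀ n, Algebra O (C n)]
variable (S : ProlongationSeq D C)

/-- The ideal `(c, δ c, …, δ^n c)` of `C n`. -/
def deltaIdeal (c : C 0) (n : ℕ) : Ideal (C n) :=
  Ideal.span {y | ∃ (i : ℕ) (h : i ≤ n), y = S.trans h (S.deltaIter i c)}

variable {S} {c : C 0}

theorem trans_deltaIter_mem_deltaIdeal {i n : ℕ} (h : i ≤ n) :
    S.trans h (S.deltaIter i c) ∈ S.deltaIdeal c n :=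
  Ideal.subset_span ⟨i, h, rfl⟩

theorem trans_mem_deltaIdeal {n m : ℕ} (h : n ≤ m) {x : C n} (hx : x ∈ S.deltaIdeal c n) :
    S.trans h x ∈ S.deltaIdeal c m := by
  have : S.deltaIdeal c n ≤ (S.deltaIdeal c m).comap (S.trans h) := by
    refine Ideal.span_le.2 ?_
    rintro _ ⟨i, hi, rfl⟩
    rw [SetLike.mem_coe, Ideal.mem_comap, S.trans_trans]
    exact trans_deltaIter_mem_deltaIdeal _
  exact this hx

theorem u_mem_deltaIdeal {n : ℕ} {x : C n} (hx : x ∈ S.deltaIdeal c n) :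
    S.u n x ∈ S.deltaIdeal c (n + 1) := by
  have := trans_mem_deltaIdeal (Nat.le_succ n) hx
  rwa [S.trans_succ le_rfl, trans_self] at this

/-- The derivation respects the ideals: modulo `S.deltaIdeal c (n + 1)`, the pair `(u, δ)` is a
ring morphism to Witt vectors of length two which vanishes on the generators of
`S.deltaIdeal c n`. -/
theorem delta_mem_deltaIdeal {n : ℕ} {x : C n} (hx : x ∈ S.deltaIdeal c n) :
    S.δ n x ∈ S.deltaIdeal c (n + 1) := by
  let F : C n →+* PiWitt D 1 (C (n + 1) ⧸ S.deltaIdeal c (n + 1)) :=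
    (PiWitt.map (Ideal.Quotient.mkₐ O (S.deltaIdeal c (n + 1)))).toRingHom.comp (S.toWitt n)
  have h : S.deltaIdeal c n ≤ RingHom.ker F := by
    refine Ideal.span_le.2 ?_
    rintro _ ⟨i, hi, rfl⟩
    refine PiWitt.ext_one ?_ ?_
    · rw [PiWitt.coeff_zero]
      exact Ideal.Quotient.eq_zero_iff_mem.2
        (u_mem_deltaIdeal (trans_deltaIter_mem_deltaIdeal hi))
    · rw [PiWitt.coeff_zero]
      refine Ideal.Quotient.eq_zero_iff_mem.2 ?_
      change S.δ n _ ∈ _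
      rw [S.delta_trans]
      exact trans_deltaIter_mem_deltaIdeal (Nat.succ_le_succ hi)
  have h1 := congrArg (fun z => z.coeff 1) (show F x = 0 from h hx)
  rw [PiWitt.coeff_zero] at h1
  exact Ideal.Quotient.eq_zero_iff_mem.1 h1

variable (S c)

/-- The components `P_i` of the exponential map are triangular in the iterates `δ^i`: they agree
up to an element that comes from the level below and lies there in the ideal of the lower
iterates. -/
theorem exists_expCoeff_succ_eq (m : ℕ) : ∃ Q ∈ S.deltaIdeal c m,
    S.expCoeff (m + 1) c = S.deltaIter (m + 1) c + S.u m Q := by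
  induction m using Nat.strong_induction_on with
  | _ m ih =>
    have hP : ∀ i ≤ m, S.expCoeff i c ∈ S.deltaIdeal c i := by
      intro i hi
      have h0 := trans_deltaIter_mem_deltaIdeal (S := S) (c := c) (le_refl i)
      rw [trans_self] at h0
      cases i with
      | zero => rwa [expCoeff_zero]
      | succ i =>
        obtain ⟨Q, hQ, e⟩ := ih i hi
        rw [e]
        exact add_mem h0 (u_mem_deltaIdeal hQ)
    -- the summand of index `m` is `δ P_m`; all other summands come from level `m`
    have hsum : ∃ Q ∈ S.deltaIdeal c m, S.expCoeff (m + 1) c =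
        S.δ m (S.expCoeff m c) + S.u m Q := by
      refine ⟨∑ i : Fin m, aeval ![S.trans i.2.le (S.expCoeff i c) ^ D.q,
        S.trans i.2 (S.δ i (S.expCoeff i c))] (D.powPoly (m - i)), ?_, ?_⟩
      · refine sum_mem fun i _ => MvPolynomial.aeval_mem_of_constantCoeff_eq_zero (fun s => ?_)
          (D.constantCoeff_powPoly _)
        fin_cases s
        · exact Ideal.pow_mem_of_mem _ (trans_mem_deltaIdeal _ (hP i i.2.le)) _ D.q_pos
        · exact trans_mem_deltaIdeal _ (delta_mem_deltaIdeal (hP i i.2.le))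
      · rw [expCoeff_succ, Fin.sum_univ_castSucc, map_sum]
        refine (add_comm _ _).trans ?_
        congr 1
        · simp [PiDatum.powPoly_zero]
        · refine Finset.sum_congr rfl fun i _ => ?_
          rw [PiWitt.aeval_pair, map_pow, ← S.trans_succ, ← S.trans_succ]
          rfl
    -- expand `δ P_m` by the induction hypothesis: the error of additivity of `δ` is `addPoly`
    obtain ⟨Q, hQ, e⟩ := hsum
    cases m with
    | zero => exact ⟨Q, hQ, by rw [e, expCoeff_zero]; rfl⟩
    | succ k =>
      obtain ⟨Q', hQ', e'⟩ := ih k (Nat.lt_succ_self k)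
      have h0 := trans_deltaIter_mem_deltaIdeal (S := S) (c := c) (le_refl (k + 1))
      rw [trans_self] at h0
      refine ⟨S.δ k Q' + aeval ![S.deltaIter (k + 1) c, S.u k Q'] D.addPoly + Q,
        add_mem (add_mem (delta_mem_deltaIdeal hQ') ?_) hQ, ?_⟩
      · refine MvPolynomial.aeval_mem_of_constantCoeff_eq_zero (fun s => ?_)
          D.constantCoeff_addPoly
        fin_cases s
        · exact h0
        · exact u_mem_deltaIdeal hQ'
      · rw [e, e', (S.isPiDerivation _).map_add, map_add, map_add, PiWitt.aeval_pair, S.u_delta]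
        simp only [deltaIter, Function.comp_apply]
        ring

/-- A ring morphism out of `C n` kills `c, δ c, …, δ^n c` if and only if it kills the components
of `exp_n c`. -/
theorem forall_deltaIter_eq_zero_iff {n : ℕ} {B : Type w} [CommRing B] (θ : C n →+* B) :
    (∀ (i : ℕ) (h : i ≤ n), θ (S.trans h (S.deltaIter i c)) = 0) ↔
      ∀ (i : ℕ) (h : i ≤ n), θ (S.trans h (S.expCoeff i c)) = 0 := by
  -- the correction term between `P_{i+1} c` and `δ^{i+1} c` is killed with the lower iterates
  have key : ∀ (i : ℕ) (h : i + 1 ≤ n),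
      (∀ (j : ℕ) (hj : j ≤ i), θ (S.trans (hj.trans (Nat.le_of_succ_le h)) (S.deltaIter j c)) = 0) →
        θ (S.trans h (S.expCoeff (i + 1) c)) = θ (S.trans h (S.deltaIter (i + 1) c)) := by
    intro i h hi
    obtain ⟨Q, hQ, e⟩ := S.exists_expCoeff_succ_eq c i
    have hle : S.deltaIdeal c i ≤
        RingHom.ker (θ.comp (S.trans (Nat.le_of_succ_le h)).toRingHom) := by
      refine Ideal.span_le.2 ?_
      rintro _ ⟨j, hj, rfl⟩
      change θ (S.trans _ (S.trans _ _)) = 0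
      rw [S.trans_trans]
      exact hi j hj
    have h0 : θ (S.trans (Nat.le_of_succ_le h) Q) = 0 := hle hQ
    rw [e, map_add, map_add, S.trans_u, h0, add_zero]
  constructor
  · intro hδ i h
    cases i with
    | zero => simpa [expCoeff_zero, deltaIter] using hδ 0 h
    | succ i => rw [key i h fun j hj => hδ j _, hδ]
  · intro hP i
    induction i using Nat.strong_induction_on with
    | _ i ih =>
      intro h
      cases i with
      | zero => simpa [expCoeff_zero, deltaIter] using hP 0 h
      | succ i => rw [← key i h fun j hj => ih j (Nat.lt_succ_of_le hj) _, hP]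

end

end ProlongationSeq

/-! ### Morphisms out of the jet polynomial sequence -/

namespace ProlongationSeq

section

variable {O : Type u} [CommRing O] [IsDedekindDomain O] {D : PiDatum O}
variable {C : ℕ → Type v} [∀ n, CommRing (C n)] [∀ n, Algebra O (C n)]
variable (S : ProlongationSeq D C) (Γ : Type w)

/-- The inclusion of the coefficients `C_*` in the jet polynomial sequence `C_*[x, x^(1), …]`. -/
noncomputable def polyC : S.Hom (S.poly Γ) where
  f n := IsScalarTower.toAlgHom O (C n) (MvPolynomial (Γ × Fin (n + 1)) (C n))
  comm_u n x := (S.poly_u_C Γ n x).symm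
  comm_delta n x := (S.poly_delta_C Γ n x).symm

theorem poly_trans_C {i n : ℕ} (h : i ≤ n) (a : C i) :
    (S.poly Γ).trans h (MvPolynomial.C a) = MvPolynomial.C (S.trans h a) :=
  ((S.polyC Γ).comm_trans h a).symm

theorem poly_trans_X {i n : ℕ} (h : i ≤ n) (s : Γ × Fin (i + 1)) :
    (S.poly Γ).trans h (X s) = X (s.1, Fin.castLE (Nat.succ_le_succ h) s.2) := by
  induction n, h using Nat.le_induction with
  | base => simp
  | succ k hk ih =>
    rw [(S.poly Γ).trans_succ hk, ih, poly_u_X]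
    rfl

theorem poly_deltaIter_X (i : ℕ) (γ : Γ) :
    (S.poly Γ).deltaIter i (X (γ, 0)) = X (γ, Fin.last i) := by
  induction i with
  | zero => rfl
  | succ i ih => rw [deltaIter, Function.comp_apply, ih, poly_delta_X, Fin.succ_last]

variable {S Γ} {n : ℕ} {B : Type*} [CommRing B] [Algebra (C n) B]
variable {θ θ' : MvPolynomial (Γ × Fin (n + 1)) (C n) →ₐ[C n] B}

/-- Two morphisms which agree on the indeterminates of order at most `i` agree on all of level
`i`. -/
theorem poly_trans_congr {i : ℕ} (hi : i ≤ n)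
    (h : ∀ (γ : Γ) (j : Fin (n + 1)), (j : ℕ) ≤ i → θ (X (γ, j)) = θ' (X (γ, j)))
    (x : MvPolynomial (Γ × Fin (i + 1)) (C i)) :
    θ ((S.poly Γ).trans hi x) = θ' ((S.poly Γ).trans hi x) := by
  have e : θ.toRingHom.comp ((S.poly Γ).trans hi).toRingHom =
      θ'.toRingHom.comp ((S.poly Γ).trans hi).toRingHom := by
    refine MvPolynomial.ringHom_ext (fun a => ?_) (fun s => ?_)
    · change θ ((S.poly Γ).trans hi (MvPolynomial.C a)) =
        θ' ((S.poly Γ).trans hi (MvPolynomial.C a))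
      rw [poly_trans_C]
      exact (θ.commutes _).trans (θ'.commutes _).symm
    · change θ ((S.poly Γ).trans hi (X s)) = θ' ((S.poly Γ).trans hi (X s))
      rw [poly_trans_X]
      exact h _ _ (Nat.lt_succ_iff.1 s.2.2)
  exact RingHom.congr_fun e x

/-- The difference `P_i(x_γ) - x_γ^(i)` involves only the indeterminates of order less than `i`,
expressed by evaluation: its image depends only on the images of these. -/
theorem poly_expCoeff_X_sub_congr {i : ℕ} (hi : i ≤ n)
    (h : ∀ (γ : Γ) (j : Fin (n + 1)), (j : ℕ) < i → θ (X (γ, j)) = θ' (X (γ, j))) (γ : Γ) :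
    θ ((S.poly Γ).trans hi ((S.poly Γ).expCoeff i (X (γ, 0)))) -
        θ (X (γ, ⟨i, Nat.lt_succ_of_le hi⟩)) =
      θ' ((S.poly Γ).trans hi ((S.poly Γ).expCoeff i (X (γ, 0)))) -
        θ' (X (γ, ⟨i, Nat.lt_succ_of_le hi⟩)) := by
  cases i with
  | zero =>
    rw [expCoeff_zero, poly_trans_X]
    exact (sub_self _).trans (sub_self _).symm
  | succ i =>
    obtain ⟨Q, -, e⟩ := (S.poly Γ).exists_expCoeff_succ_eq (X (γ, 0)) i
    rw [e, map_add, poly_deltaIter_X, poly_trans_X, map_add, map_add, (S.poly Γ).trans_u,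
      poly_trans_congr _ (fun γ j hj => h γ j (Nat.lt_succ_of_le hj))]
    exact (add_sub_cancel_left _ _).trans (add_sub_cancel_left _ _).symm

/-- A morphism out of `C_n[x, …, x^(n)]` is determined by its values at the components of
`exp_n(x_γ)`. -/
theorem poly_algHom_ext (h : ∀ (γ : Γ) (i : ℕ) (hi : i ≤ n),
    θ ((S.poly Γ).trans hi ((S.poly Γ).expCoeff i (X (γ, 0)))) =
      θ' ((S.poly Γ).trans hi ((S.poly Γ).expCoeff i (X (γ, 0))))) : θ = θ' := by
  have key : ∀ (i : ℕ) (hi : i < n + 1) (γ : Γ), θ (X (γ, ⟨i, hi⟩)) = θ' (X (γ, ⟨i, hi⟩)) := by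
    intro i
    induction i using Nat.strong_induction_on with
    | _ i ih =>
      intro hi γ
      have := poly_expCoeff_X_sub_congr (S := S) (Nat.lt_succ_iff.1 hi)
        (fun γ j hj => ih j hj j.2 γ) γ
      rw [h] at this
      exact sub_right_injective this
  exact MvPolynomial.algHom_ext fun s => key s.2 s.2.2 s.1

/-- A morphism out of `C_n[x, …, x^(n)]` may take any prescribed values at the components of
`exp_n(x_γ)`. -/
theorem exists_poly_algHom (w : Γ → Fin (n + 1) → B) :
    ∃ θ : MvPolynomial (Γ × Fin (n + 1)) (C n) →ₐ[C n] B, ∀ (γ : Γ) (i : ℕ) (hi : i ≤ n),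
      θ ((S.poly Γ).trans hi ((S.poly Γ).expCoeff i (X (γ, 0)))) =
        w γ ⟨i, Nat.lt_succ_of_le hi⟩ := by
  have key : ∀ m : ℕ, ∃ t : Γ × Fin (n + 1) → B, ∀ (γ : Γ) (i : ℕ) (hi : i ≤ n), i < m →
      (aeval t : MvPolynomial _ (C n) →ₐ[C n] B)
        ((S.poly Γ).trans hi ((S.poly Γ).expCoeff i (X (γ, 0)))) =
          w γ ⟨i, Nat.lt_succ_of_le hi⟩ := by
    intro m
    induction m with
    | zero => exact ⟨0, fun _ _ _ h => absurd h (Nat.not_lt_zero _)⟩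
    | succ m ih =>
      obtain ⟨t, ht⟩ := ih
      -- changing the values at `x_γ^(m)` corrects the `m`-th component and keeps the lower ones
      let t' : Γ × Fin (n + 1) → B := fun s => if (s.2 : ℕ) = m then
        t s + (w s.1 s.2 - (aeval t : MvPolynomial _ (C n) →ₐ[C n] B)
          ((S.poly Γ).trans (Nat.lt_succ_iff.1 s.2.2) ((S.poly Γ).expCoeff s.2 (X (s.1, 0)))))
        else t s
      have hlt : ∀ (γ : Γ) (j : Fin (n + 1)), (j : ℕ) < m →
          (aeval t' : MvPolynomial _ (C n) →ₐ[C n] B) (X (γ, j)) =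
            (aeval t : MvPolynomial _ (C n) →ₐ[C n] B) (X (γ, j)) := by
        intro γ j hj
        simp [t', hj.ne]
      refine ⟨t', fun γ i hi him => ?_⟩
      rcases Nat.lt_succ_iff_lt_or_eq.1 him with him | rfl
      · rw [← ht γ i hi him]
        exact poly_trans_congr hi (fun γ j hj => hlt γ j (hj.trans_lt him)) _
      · have h := poly_expCoeff_X_sub_congr (S := S) hi hlt γ
        rw [aeval_X, aeval_X, sub_eq_iff_eq_add] at h
        have e : t' (γ, ⟨i, Nat.lt_succ_of_le hi⟩) = t (γ, ⟨i, Nat.lt_succ_of_le hi⟩) +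
            (w γ ⟨i, Nat.lt_succ_of_le hi⟩ - (aeval t : MvPolynomial _ (C n) →ₐ[C n] B)
              ((S.poly Γ).trans hi ((S.poly Γ).expCoeff i (X (γ, 0))))) := if_pos rfl
        rw [h, e]
        ring
  obtain ⟨t, ht⟩ := key (n + 1)
  exact ⟨aeval t, fun γ i hi => ht γ i hi (Nat.lt_succ_of_le hi)⟩

end

/-! ### Morphisms to Witt vectors and the jet ideal -/

section

variable {O : Type u} [CommRing O] [IsDedekindDomain O] {D : PiDatum O}
variable {C : ℕ → Type v} [∀ n, CommRing (C n)] [∀ n, Algebra O (C n)]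
variable (S : ProlongationSeq D C) {Γ : Type w} {n : ℕ}
variable {B : Type*} [CommRing B] [Algebra O B] [Algebra (C n) B] [IsScalarTower O (C n) B]

/-- The morphism `C_0[x] → W_n(C_n[x, …, x^(n)]) → W_n(B)` attached to a morphism
`θ : C_n[x, …, x^(n)] → B`. -/
noncomputable def polyAdjunct (θ : MvPolynomial (Γ × Fin (n + 1)) (C n) →ₐ[C n] B) :
    MvPolynomial (Γ × Fin (0 + 1)) (C 0) →ₐ[O] PiWitt D n B :=
  (PiWitt.map (θ.restrictScalars O)).comp ((S.poly Γ).exp n)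

theorem polyAdjunct_coeff (θ : MvPolynomial (Γ × Fin (n + 1)) (C n) →ₐ[C n] B)
    (f : MvPolynomial (Γ × Fin (0 + 1)) (C 0)) (i : Fin (n + 1)) :
    (S.polyAdjunct θ f).coeff i =
      θ ((S.poly Γ).trans (Nat.lt_succ_iff.1 i.2) ((S.poly Γ).expCoeff i f)) := rfl

theorem polyAdjunct_C (θ : MvPolynomial (Γ × Fin (n + 1)) (C n) →ₐ[C n] B) (a : C 0) :
    S.polyAdjunct θ (MvPolynomial.C a) =
      PiWitt.map (IsScalarTower.toAlgHom O (C n) B) (S.exp n a) := by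
  have h : (S.poly Γ).exp n (MvPolynomial.C a) = PiWitt.map ((S.polyC Γ).f n) (S.exp n a) :=
    ((S.polyC Γ).comm_expFun n a).symm
  rw [polyAdjunct, AlgHom.comp_apply, h]
  ext i
  exact θ.commutes _

theorem polyAdjunct_eq_zero_iff (θ : MvPolynomial (Γ × Fin (n + 1)) (C n) →ₐ[C n] B)
    (f : MvPolynomial (Γ × Fin (0 + 1)) (C 0)) : S.polyAdjunct θ f = 0 ↔
      ∀ (i : ℕ) (h : i ≤ n), θ ((S.poly Γ).trans h ((S.poly Γ).deltaIter i f)) = 0 := by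
  rw [PiWitt.ext_iff, funext_iff]
  simp only [PiWitt.coeff_zero, polyAdjunct_coeff]
  refine Iff.trans ?_ ((S.poly Γ).forall_deltaIter_eq_zero_iff f θ.toRingHom).symm
  exact ⟨fun h i hi => h ⟨i, Nat.lt_succ_of_le hi⟩, fun h i => h i _⟩

/-- The adjunct kills a set of polynomials exactly when the morphism kills the jet ideal. -/
theorem jetIdeal_le_ker_iff (θ : MvPolynomial (Γ × Fin (n + 1)) (C n) →ₐ[C n] B)
    (s : Set (MvPolynomial (Γ × Fin (0 + 1)) (C 0))) :
    S.jetIdeal Γ s n ≤ RingHom.ker θ ↔ ∀ f ∈ s, S.polyAdjunct θ f = 0 := by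
  simp only [polyAdjunct_eq_zero_iff, jetIdeal, Ideal.span_le]
  constructor
  · exact fun h f hf i hi => h ⟨f, hf, i, hi, rfl⟩
  · rintro h _ ⟨f, hf, i, hi, rfl⟩
    exact h f hf i hi

end

/-! ### The adjunction -/

section

variable {O : Type u} [CommRing O] [IsDedekindDomain O] {D : PiDatum O}
variable {C : ℕ → Type v} [∀ n, CommRing (C n)] [∀ n, Algebra O (C n)]
variable (S : ProlongationSeq D C) {n : ℕ}
variable {A : Type v} [CommRing A] [Algebra (C 0) A] {B : Type v} [CommRing B] [Algebra (C n) B]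

theorem pres_surjective (R A : Type v) [CommRing R] [CommRing A] [Algebra R A] :
    Function.Surjective (pres R A) := fun a => ⟨X (a, 0), by simp [pres]⟩

theorem wittObj_hom_ext {f g : CommAlgCat.of (C 0) A ⟶ S.wittObj n B}
    (h : ∀ a i, PiWitt.coeff (D := D) (B := B) (f.hom a) i =
      PiWitt.coeff (D := D) (B := B) (g.hom a) i) : f = g := by
  refine CommAlgCat.hom_ext (AlgHom.ext fun a => ?_)
  exact PiWitt.ext (funext (h a))

/-- The morphism `A → W_n(B)` corresponding to `φ : J_n A → B`: it maps `a` to the image of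
`exp_n(x_a)`. -/
noncomputable def jetAdjunct (φ : S.Jet n A →ₐ[C n] B) :
    CommAlgCat.of (C 0) A ⟶ S.wittObj n B :=
  letI := restrictAlgebra O (C n) B
  haveI : IsScalarTower O (C n) B := .of_algebraMap_eq fun _ => rfl
  letI : Algebra (C 0) (PiWitt D n B) :=
    ((PiWitt.map (structureHom O (C n) B)).comp (S.exp n)).toRingHom.toAlgebra
  letI θ : MvPolynomial (A × Fin (n + 1)) (C n) →ₐ[C n] B :=
    φ.comp (Ideal.Quotient.mkₐ (C n) (S.jetIdeal A {f | pres (C 0) A f = 0} n))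
  CommAlgCat.ofHom (X := A) (Y := PiWitt D n B)
    (AlgHom.liftOfSurjective (pres (C 0) A) (pres_surjective (C 0) A)
      { S.polyAdjunct θ with commutes' := fun a => S.polyAdjunct_C θ a }
      (fun f hf => (S.jetIdeal_le_ker_iff θ {f | pres (C 0) A f = 0}).1
        (fun _ hx => (congrArg φ (Ideal.Quotient.eq_zero_iff_mem.2 hx)).trans (map_zero φ)) f hf))

theorem jetAdjunct_coeff (φ : S.Jet n A →ₐ[C n] B) (a : A) (i : Fin (n + 1)) :
    PiWitt.coeff (D := D) (B := B) ((S.jetAdjunct φ).hom a) i =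
      φ (Ideal.Quotient.mk _ ((S.poly A).trans (Nat.lt_succ_iff.1 i.2)
        ((S.poly A).expCoeff i (X (a, 0))))) := by
  let := restrictAlgebra O (C n) B
  have : IsScalarTower O (C n) B := .of_algebraMap_eq fun _ => rfl
  let : Algebra (C 0) (PiWitt D n B) :=
    ((PiWitt.map (structureHom O (C n) B)).comp (S.exp n)).toRingHom.toAlgebra
  have h : a = pres (C 0) A (X (a, 0)) := by simp [pres]
  conv_lhs => rw [h]
  exact congrArg (fun z : PiWitt D n B => z.coeff i)
    (AlgHom.liftOfSurjective_apply (pres (C 0) A) (pres_surjective (C 0) A) _ _ (X (a, 0)))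

theorem jetAdjunct_injective :
    Function.Injective (S.jetAdjunct : (S.Jet n A →ₐ[C n] B) → _) := by
  intro φ φ' h
  refine Ideal.Quotient.algHom_ext _ (poly_algHom_ext (S := S) fun a i hi => ?_)
  have e := congrArg (fun f => PiWitt.coeff (D := D) (B := B) (CommAlgCat.Hom.hom f a)
    ⟨i, Nat.lt_succ_of_le hi⟩) h
  exact ((S.jetAdjunct_coeff φ a _).symm.trans e).trans (S.jetAdjunct_coeff φ' a _)

theorem jetAdjunct_surjective :
    Function.Surjective (S.jetAdjunct : (S.Jet n A →ₐ[C n] B) → _) := by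
  intro ψ
  let := restrictAlgebra O (C n) B
  have : IsScalarTower O (C n) B := .of_algebraMap_eq fun _ => rfl
  let : Algebra (C 0) (PiWitt D n B) :=
    ((PiWitt.map (structureHom O (C n) B)).comp (S.exp n)).toRingHom.toAlgebra
  let ψ' : A →ₐ[C 0] PiWitt D n B := ψ.hom
  obtain ⟨θ, hθ⟩ := exists_poly_algHom (S := S) fun a => (ψ' a).coeff
  have h : (S.polyAdjunct θ).toRingHom = (ψ'.comp (pres (C 0) A)).toRingHom := by
    refine MvPolynomial.ringHom_ext (fun c => ?_) (fun s => ?_)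
    · refine (S.polyAdjunct_C θ c).trans ?_
      exact ((ψ'.comp (pres (C 0) A)).commutes c).symm
    · obtain ⟨a, j⟩ := s
      obtain rfl : j = 0 := Fin.fin_one_eq_zero j
      change S.polyAdjunct θ (X (a, 0)) = ψ' (pres (C 0) A (X (a, 0)))
      ext i
      rw [polyAdjunct_coeff, hθ]
      simp [pres]
  have hle := (S.jetIdeal_le_ker_iff θ {f | pres (C 0) A f = 0}).2 fun f hf => by
    have := RingHom.congr_fun h f
    refine this.trans ?_
    change ψ' (pres (C 0) A f) = 0
    rw [show pres (C 0) A f = 0 from hf, map_zero]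
  refine ⟨Ideal.Quotient.liftₐ _ θ fun x hx => hle hx, ?_⟩
  refine S.wittObj_hom_ext fun a i => ?_
  rw [jetAdjunct_coeff]
  exact hθ a i _

theorem jetAdjunct_jetMap {A' : Type v} [CommRing A'] [Algebra (C 0) A'] (f : A' →ₐ[C 0] A)
    (φ : S.Jet n A →ₐ[C n] B) :
    S.jetAdjunct (φ.comp (S.jetMap n f)) = CommAlgCat.ofHom f ≫ S.jetAdjunct φ := by
  refine S.wittObj_hom_ext fun a i => ?_
  rw [jetAdjunct_coeff]
  refine Eq.trans ?_ (S.jetAdjunct_coeff φ (f a) i).symm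
  rw [AlgHom.comp_apply, jetMap_mk]
  have h := (S.polyMap (f : A' → A)).comm_trans (Nat.lt_succ_iff.1 i.2)
    ((S.poly A').expCoeff i (X (a, 0)))
  rw [Hom.comm_expCoeff, polyMap_apply, polyMap_apply, rename_X] at h
  exact congrArg (fun x => φ (Ideal.Quotient.mk _ x)) h

theorem jetAdjunct_comp {B' : Type v} [CommRing B'] [Algebra (C n) B']
    (φ : S.Jet n A →ₐ[C n] B) (g : B →ₐ[C n] B') :
    S.jetAdjunct (g.comp φ) = S.jetAdjunct φ ≫ S.wittMap n g := by
  refine S.wittObj_hom_ext fun a i => ?_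
  rw [jetAdjunct_coeff]
  exact (congrArg g (S.jetAdjunct_coeff φ a i)).symm

variable (n)

/-- The adjunction between the `π`-jet functor and the truncated Witt vector functor. -/
noncomputable def jetWittAdjunction : S.jetFunctor n ⊣ S.wittFunctor n :=
  let e (A : CommAlgCat.{v} (C 0)) (B : CommAlgCat.{v} (C n)) :
      ((S.jetFunctor n).obj A ⟶ B) ≃ (A ⟶ (S.wittFunctor n).obj B) :=
    Equiv.ofBijective (fun φ => S.jetAdjunct φ.hom)
      ⟨fun _ _ h => CommAlgCat.hom_ext (S.jetAdjunct_injective h), fun ψ =>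
        (S.jetAdjunct_surjective ψ).imp' CommAlgCat.ofHom fun _ h => h⟩
  Adjunction.mkOfHomEquiv
    { homEquiv := e
      homEquiv_naturality_left_symm := fun {A' A B} f ψ => by
        rw [Equiv.symm_apply_eq]
        obtain ⟨φ, rfl⟩ := (e A B).surjective ψ
        rw [Equiv.symm_apply_apply]
        exact (S.jetAdjunct_jetMap f.hom φ.hom).symm
      homEquiv_naturality_right := fun φ g => S.jetAdjunct_comp φ.hom g.hom }

end

end ProlongationSeq

theorem theorem2p4 {O : Type u} [CommRing O] [IsDedekindDomain O] (D : PiDatum O)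
    {R : ℕ → Type v} [∀ n, CommRing (R n)] [∀ n, Algebra O (R n)] (S : ProlongationSeq D R)
    (n : ℕ) : Nonempty (S.jetFunctor n ⊣ S.wittFunctor n) :=
  ⟨S.jetWittAdjunction n⟩
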